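/- Let $d\ge 2$, and let $G$ be the semigroup of $d\times d$ real matrices with nonnegative entries such that every row and every column contains a strictly positive entry; let $G^+\subset G$ be the set of matrices with strictly positive entries. Equip $\mathbb R^d$ with the $\ell^1$ norm $\|\cdot\|$, matrices with the associated operator norm, $G$ with the induced topology, and put $S^+=\{x\in\mathbb R^d : \|x\|=1,\ x_i\ge 0\ \forall i\}$. For $g\in G$ let $v(g)=\inf_{x\in S^+}\|gx\|>0$, $N(g)=\max(\|g\|,1/v(g))$, and let $\kappa(g)$ be the spectral radius of $g$. Let $\mu$ be a Borel probability measure on $G$ that is strictly contracting, i.e. $\mu^{*r}(G^+)>0$ for some integer $r\ge 1$, and let $\tilde\mu$ be the image of $\mu$ under transposition $g\mapsto g^t$. Assume that $\tilde\mu$ admits a moment of order 1, i.e. $\int_G\log N(g)\,d\tilde\mu(g)<\infty$. Let $(Y_n)_{n\ge1}$ be i.i.d. random variables with law $\mu$ on a probability space $(\Omega,\mathcal F,\mathbb P)$, let $A_n=Y_n\cdots Y_1$, and let $\lambda_\mu=\lim_{n\to\infty}\frac1n\mathbb E\log\|A_n\|\in\mathbb R$ (this limit exists and depends only on $\mu$).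 Then, with the convention $\log 0=-\infty$: 1. $\displaystyle \sup_{x,y\in S^+}\Big|\frac{\log\langle y,A_nx\rangle}{n}-\lambda_\mu\Big|\longrightarrow 0$ $\mathbb P$-a.s. as $n\to\infty$; in particular $\displaystyle\Big|\frac{\inf_{x,y\in S^+}\log\langle y,A_nx\rangle}{n}-\lambda_\mu\Big|\longrightarrow0$ $\mathbb P$-a.s. 2. $\frac1n\log\|A_n\|$ and $\frac1n\log\kappa(A_n)$ converge to $\lambda_\mu$, both $\mathbb P$-a.s. and in $L^1(\mathbb P)$. 3. $\frac1n\log v(A_n)$ converges to $\lambda_\mu$ $\mathbb P$-a.s. -/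

import Mathlib

open MeasureTheory ProbabilityTheory Filter Topology
open scoped ENNReal Matrix

namespace PositiveMatrix

/-- The semigroup `G` of `d × d` real matrices with nonnegative entries that are allowable: every
row and every column contains a strictly positive entry. -/
def allowable (d : ℕ) : Submonoid (Matrix (Fin d) (Fin d) ℝ) where
  carrier := {g | (∀ i j, 0 ≤ g i j) ∧ (∀ i, ∃ j, 0 < g i j) ∧ (∀ j, ∃ i, 0 < g i j)}
  one_mem' := by
    refine ⟨fun i j => ?_, fun i => ⟨i, by simp⟩, fun i => ⟨i, by simp⟩⟩
    rw [Matrix.one_apply]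
    split_ifs
    · exact zero_le_one
    · exact le_rfl
  mul_mem' := by
    rintro a b ⟨ha, har, hac⟩ ⟨hb, hbr, hbc⟩
    refine ⟨fun i j => ?_, fun i => ?_, fun j => ?_⟩
    · rw [Matrix.mul_apply]
      exact Finset.sum_nonneg fun k _ => mul_nonneg (ha i k) (hb k j)
    · obtain ⟨k, hk⟩ := har i
      obtain ⟨j, hj⟩ := hbr k
      refine ⟨j, ?_⟩
      rw [Matrix.mul_apply]
      exact Finset.sum_pos' (fun k _ => mul_nonneg (ha i k) (hb k j))
        ⟨k, Finset.mem_univ k, mul_pos hk hj⟩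
    · obtain ⟨k, hk⟩ := hbc j
      obtain ⟨i, hi⟩ := hac k
      refine ⟨i, ?_⟩
      rw [Matrix.mul_apply]
      exact Finset.sum_pos' (fun k _ => mul_nonneg (ha i k) (hb k j))
        ⟨k, Finset.mem_univ k, mul_pos hi hk⟩

/-- `G` carries the Borel σ-algebra of the topology inherited from the space of matrices. -/
instance allowableMeasurableSpace (d : ℕ) : MeasurableSpace (allowable d) := borel (allowable d)

instance allowableBorelSpace (d : ℕ) : BorelSpace (allowable d) := ⟨rfl⟩

/-- The transposition `g ↦ gᵗ` on `G`. -/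
def transpose {d : ℕ} (g : allowable d) : allowable d :=
  ⟨(g : Matrix (Fin d) (Fin d) ℝ)ᵀ, fun i j => g.2.1 j i, g.2.2.2, g.2.2.1⟩

/-- The set `G⁺` of elements of `G` all of whose entries are strictly positive. -/
def strictlyPositive (d : ℕ) : Set (allowable d) :=
  {g | ∀ i j, 0 < (g : Matrix (Fin d) (Fin d) ℝ) i j}

/-- The `ℓ¹` norm of a vector of `ℝ^d`. -/
noncomputable def l1Norm {d : ℕ} (x : Fin d → ℝ) : ℝ :=
  ‖(WithLp.toLp 1 x : PiLp 1 fun _ : Fin d => ℝ)‖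

/-- The set `S⁺` of vectors with nonnegative coordinates and `ℓ¹` norm equal to `1`. -/
def unitSimplex (d : ℕ) : Set (Fin d → ℝ) :=
  {x | l1Norm x = 1 ∧ ∀ i, 0 ≤ x i}

/-- The operator norm `‖g‖` of a matrix acting on `ℝ^d` with the `ℓ¹` norm. -/
noncomputable def opNorm {d : ℕ} (g : Matrix (Fin d) (Fin d) ℝ) : ℝ :=
  ‖(Matrix.toLpLin 1 1 g).toContinuousLinearMap‖

/-- `v(g) = inf_{x ∈ S⁺} ‖g x‖`. -/
noncomputable def vInf {d : ℕ} (g : Matrix (Fin d) (Fin d) ℝ) : ℝ :=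
  ⨅ x : unitSimplex d, l1Norm (g *ᵥ (x : Fin d → ℝ))

/-- `N(g) = max(‖g‖, 1 / v(g))`. -/
noncomputable def bigN {d : ℕ} (g : Matrix (Fin d) (Fin d) ℝ) : ℝ :=
  max (opNorm g) (1 / vInf g)

/-- The spectral radius `κ(g)`: the largest modulus of a complex eigenvalue of `g`. -/
noncomputable def specRadius {d : ℕ} (g : Matrix (Fin d) (Fin d) ℝ) : ℝ :=
  (spectralRadius ℂ (g.map (algebraMap ℝ ℂ))).toReal

/-- `μ` admits a moment of order `p`: `∫ (log N(g))^p dμ(g) < ∞`. -/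
def HasMoment {d : ℕ} (μ : Measure (allowable d)) (p : ℝ) : Prop :=
  ∫⁻ g, ENNReal.ofReal (Real.log (bigN (g : Matrix (Fin d) (Fin d) ℝ)) ^ p) ∂μ < ⊤

/-- The convolution powers `μ^{*r}` on `G`. -/
noncomputable def convPow {d : ℕ} (μ : Measure (allowable d)) : ℕ → Measure (allowable d)
  | 0 => Measure.dirac 1
  | r + 1 => Measure.mconv μ (convPow μ r)

/-- `μ` is strictly contracting: `μ^{*r}(G⁺) > 0` for some `r ≥ 1`. -/
def StrictlyContracting {d : ℕ} (μ : Measure (allowable d)) : Prop :=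
  ∃ r : ℕ, 1 ≤ r ∧ 0 < convPow μ r (strictlyPositive d)

/-- The Lyapunov exponent `λ_μ`, the limit of `n⁻¹ 𝔼 log ‖Aₙ‖` where `Aₙ` is a product of `n`
independent matrices of law `μ`, so that `Aₙ` has law `μ^{*n}`. -/
noncomputable def lyapunov {d : ℕ} (μ : Measure (allowable d)) : ℝ :=
  limUnder atTop fun n : ℕ =>
    (∫ g, Real.log (opNorm (g : Matrix (Fin d) (Fin d) ℝ)) ∂(convPow μ n)) / (n : ℝ)

/-- The left products `Aₙ = Yₙ ⋯ Y₁`. The sequence `Y₁, Y₂, …` is indexed from `0`, so that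
`Y k` stands for `Y_{k+1}`; `A₀` is the identity. -/
def leftProd {d : ℕ} {Ω : Type*} (Y : ℕ → Ω → allowable d) : ℕ → Ω → allowable d
  | 0, _ => 1
  | n + 1, ω => Y n ω * leftProd Y n ω

/-- `log ⟨y, g x⟩` with values in `[-∞, ∞]`, equal to `-∞` when `⟨y, g x⟩ = 0`. -/
noncomputable def logCoeff {d : ℕ} (g : Matrix (Fin d) (Fin d) ℝ) (x y : Fin d → ℝ) : EReal :=
  ENNReal.log (ENNReal.ofReal (y ⬝ᵥ (g *ᵥ x)))

/-- `X n → c` in `L¹(P)`, with each `X n` in `L¹(P)`. -/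
def TendstoInL1 {Ω : Type*} [MeasurableSpace Ω] (P : Measure Ω) (X : ℕ → Ω → ℝ) (c : ℝ) : Prop :=
  (∀ n, Integrable (X n) P) ∧ Tendsto (fun n => ∫ ω, |X n ω - c| ∂P) atTop (𝓝 0)

end PositiveMatrix

namespace PositiveMatrix

/-! ### Averages of real sequences -/

/-! Every quantity in the theorem (coefficients on the simplex, operator norm, spectral radius,
`vInf`) lies between the smallest entry and the sum of the entries of the product. So it suffices
that the logarithms of both extremes grow almost surely at rate λ, which is
`ae_tendsto_log_minEntry_and_log_entrySum`.

The sum of entries is submultiplicative and comparable to the operator norm, so its expected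
logarithm is subadditive with rate λ. Choosing a block length L with mean rate below λ + δ and
applying the law of large numbers to independent blocks gives the upper bound;
`eventually_le_mul_of_block_le` handles the incomplete last block.

For the lower bound, the key inequality is min(ghk) ≥ min(g) · sum(h) · min(k), proved in
`minEntry_mul_entrySum_mul_minEntry_le`. Time is cut into cycles of L + R steps: h is the product of
the first L matrices, g that of the next R, k the whole past. Strict contraction makes the products
eventually positive, so for suitable R and ε one has min(g) ≥ ε except with small probability p. A
good cycle gains log sum(h) up to a constant. A bad one is bounded through row sums, at a cost
linear in `logSize`. Since the bad event concerns g only, it is independent of h, and the expected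
cost over h is p L z with z the mean of `logSize`. Taking p z < δ and then L large, the mean gain
per step exceeds λ - δ (`exists_integral_cycleBound`), and the law of large numbers for cycles
concludes. No ergodic theorem is needed.

The smallest row sum of g is v of its transpose; this is why the moment condition bears on the
transposed law and why it makes `logSize` integrable. For convergence in mean, |log f(Aₙ)| / n is
dominated by the empirical mean of `logSize` as soon as f lies between the smallest row sum and the
sum of entries. That mean converges in L¹ by the law of large numbers, so domination and almost sure
convergence suffice (`tendsto_integral_abs_sub_zero`). -/

lemma tendsto_natDiv_div (L : ℕ) (hL : 0 < L) :
    Tendsto (fun n : ℕ => ((n / L : ℕ) : ℝ) / n) atTop (𝓝 (1 / L)) := by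
  have h := (tendsto_nat_floor_mul_div_atTop (R := ℝ) (a := 1 / L) (by positivity)).comp
    tendsto_natCast_atTop_atTop
  refine h.congr fun n => ?_
  simp only [Function.comp]
  congr 2
  rw [one_div_mul_eq_div, Nat.floor_div_eq_div]

/-- A sequence whose increments are controlled, over blocks of length `L`, by a sequence with mean
`x` and, over unit steps, by a sequence which has some mean, grows at rate at most `x / L`. -/
lemma eventually_le_mul_of_block_le {a X Z : ℕ → ℝ} {x z : ℝ} {L N : ℕ} (hL : 0 < L)
    (hZ : ∀ n, N ≤ n → a (n + 1) ≤ a n + Z n)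
    (hX : ∀ j, N ≤ j * L → a ((j + 1) * L) ≤ a (j * L) + X j)
    (hXlim : Tendsto (fun n : ℕ => (∑ j ∈ Finset.range n, X j) / n) atTop (𝓝 x))
    (hZlim : Tendsto (fun n : ℕ => (∑ j ∈ Finset.range n, Z j) / n) atTop (𝓝 z))
    {c : ℝ} (hc : x / L < c) : ∀ᶠ n : ℕ in atTop, a n ≤ c * n := by
  set SX : ℕ → ℝ := fun n => ∑ j ∈ Finset.range n, X j with hSX
  set SZ : ℕ → ℝ := fun n => ∑ j ∈ Finset.range n, Z j with hSZ
  -- The block induction starts at block `N`, that is at time `N * L`, so that every time it uses is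
  -- at least `N`.
  have hNL : N ≤ N * L := Nat.le_mul_of_pos_right N hL
  have h1 : ∀ q, N ≤ q → a (q * L) ≤ a (N * L) + SX q - SX N := by
    intro q hq
    induction q, hq using Nat.le_induction with
    | base => simp
    | succ q hq ih =>
      have := hX q (hNL.trans (Nat.mul_le_mul_right L hq))
      have e : SX (q + 1) = SX q + X q := Finset.sum_range_succ _ _
      linarith
  have h2 : ∀ m n, N ≤ m → m ≤ n → a n ≤ a m + SZ n - SZ m := by
    intro m n hm hn
    induction n, hn using Nat.le_induction with
    | base => simp
    | succ q hq ih =>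
      have := hZ q (hm.trans hq)
      have e : SZ (q + 1) = SZ q + Z q := Finset.sum_range_succ _ _
      linarith
  have hq : Tendsto (fun n : ℕ => n / L) atTop atTop := Nat.tendsto_div_const_atTop hL.ne'
  have hqL : Tendsto (fun n : ℕ => n / L * L) atTop atTop :=
    tendsto_atTop_mono (fun n => Nat.le_mul_of_pos_right _ hL) hq
  have hdiv := tendsto_natDiv_div L hL
  have l1 : Tendsto (fun n : ℕ => SX (n / L) / n) atTop (𝓝 (x * (1 / L))) := by
    refine ((hXlim.comp hq).mul hdiv).congr' ?_
    filter_upwards [hq.eventually_gt_atTop 0] with n hn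
    have : ((n / L : ℕ) : ℝ) ≠ 0 := by exact_mod_cast hn.ne'
    simp only [Function.comp, hSX]
    field_simp
  have l2 : Tendsto (fun n : ℕ => SZ (n / L * L) / n) atTop (𝓝 (z * (1 / L * L))) := by
    refine ((hZlim.comp hqL).mul (hdiv.mul_const (L : ℝ))).congr' ?_
    filter_upwards [hq.eventually_gt_atTop 0] with n hn
    have : ((n / L : ℕ) : ℝ) ≠ 0 := by exact_mod_cast hn.ne'
    simp only [Function.comp, hSZ]
    push_cast
    field_simp
  have hL' : (L : ℝ) ≠ 0 := by exact_mod_cast hL.ne'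
  -- The unit steps after the last complete block contribute a difference of two partial sums of
  -- `Z`; divided by n, both tend to `z`, so no bound on individual terms is needed.
  have l3 : Tendsto (fun n : ℕ => (a (N * L) - SX N) / n + SX (n / L) / n + SZ n / n
      - SZ (n / L * L) / n) atTop (𝓝 (0 + x * (1 / L) + z - z * (1 / L * L))) :=
    (((tendsto_const_div_atTop_nhds_zero_nat _).add l1).add hZlim).sub l2
  have e : 0 + x * (1 / L) + z - z * (1 / L * L) = x / L := by field_simp; ring
  rw [e] at l3
  filter_upwards [l3.eventually_lt_const hc, eventually_gt_atTop 0, hq.eventually_ge_atTop N]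
    with n hn hn0 hnN
  have hn0' : (0 : ℝ) < n := by exact_mod_cast hn0
  have b1 := h1 _ hnN
  have b2 := h2 (n / L * L) n (hNL.trans (Nat.mul_le_mul_right L hnN)) (Nat.div_mul_le_self n L)
  rw [← add_div, ← add_div, ← sub_div, div_lt_iff₀ hn0'] at hn
  linarith

/-! ### Windows of sequences of independent random variables -/

section Window

variable {G : Type*}

/-- The sequence `y` shifted by `a`. -/
def shift (a : ℕ) (y : ℕ → G) : ℕ → G := fun k => y (a + k)

@[simp] lemma shift_apply (a : ℕ) (y : ℕ → G) (k : ℕ) : shift a y k = y (a + k) := rfl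

lemma shift_zero (y : ℕ → G) : shift 0 y = y := by
  funext k; simp

variable [MeasurableSpace G]

lemma measurable_shift (a : ℕ) : Measurable (shift a : (ℕ → G) → ℕ → G) :=
  measurable_pi_lambda _ fun _ => measurable_pi_apply _

variable {Ω : Type*} [MeasurableSpace Ω] {P : Measure Ω} {Y : ℕ → Ω → G}
  {μ : Measure G}

/-- The sequence of values of a sequence of random variables. -/
def path (Y : ℕ → Ω → G) (ω : Ω) : ℕ → G := fun k => Y k ω

omit [MeasurableSpace G] [MeasurableSpace Ω] in
@[simp] lemma path_apply (Y : ℕ → Ω → G) (ω : Ω) (k : ℕ) : path Y ω k = Y k ω := rfl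

lemma measurable_path (hYm : ∀ n, Measurable (Y n)) : Measurable (path Y) :=
  measurable_pi_lambda _ hYm

/-- Both laws are the infinite product of copies of `μ`. -/
lemma map_shift_path (hYm : ∀ n, Measurable (Y n)) (hYlaw : ∀ n, P.map (Y n) = μ)
    (hYind : iIndepFun Y P) (a : ℕ) :
    P.map (fun ω => shift a (path Y ω)) = P.map (path Y) := by
  have h1 := (hYind.precomp (g := fun k => a + k)
    (fun i j h => by simpa using h)).map_fun_eq_infinitePi_map₀
    (measurable_pi_lambda _ fun k => hYm (a + k)).aemeasurable
  have h2 := hYind.map_fun_eq_infinitePi_map₀ (measurable_pi_lambda _ hYm).aemeasurable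
  simp only [hYlaw] at h1 h2
  exact h1.trans h2.symm

lemma identDistrib_shift (hYm : ∀ n, Measurable (Y n)) (hYlaw : ∀ n, P.map (Y n) = μ)
    (hYind : iIndepFun Y P) {Φ : (ℕ → G) → ℝ} (hΦ : Measurable Φ) (a : ℕ) :
    IdentDistrib (fun ω => Φ (shift a (path Y ω))) (fun ω => Φ (path Y ω)) P P := by
  have h : IdentDistrib (fun ω => shift a (path Y ω)) (path Y) P P :=
    ⟨((measurable_shift a).comp (measurable_path hYm)).aemeasurable,
      (measurable_path hYm).aemeasurable, map_shift_path hYm hYlaw hYind a⟩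
  exact h.comp hΦ

/-- Each functional sees only finitely many coordinates, and the hypothesis on `a`, `b` and `K`
makes the two index windows disjoint. -/
lemma indepFun_shift [Nonempty G] (hYm : ∀ n, Measurable (Y n)) (hYind : iIndepFun Y P)
    {β γ : Type*} [MeasurableSpace β] [MeasurableSpace γ]
    {Φ : (ℕ → G) → β} {Ψ : (ℕ → G) → γ} (hΦ : Measurable Φ) (hΨ : Measurable Ψ) {a b K K' : ℕ}
    (hΦK : DependsOn Φ (Set.Iio K)) (hΨK : DependsOn Ψ (Set.Iio K')) (hab : a + K ≤ b) :
    IndepFun (fun ω => Φ (shift a (path Y ω))) (fun ω => Ψ (shift b (path Y ω))) P := by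
  classical
  have g0 : G := Classical.arbitrary G
  have hd : Disjoint (Finset.Ico a (a + K)) (Finset.Ico b (b + K')) := by
    rw [Finset.disjoint_left]
    intro i hi hi'
    simp only [Finset.mem_Ico] at hi hi'
    omega
  have h := hYind.indepFun_finset _ _ hd hYm
  -- Extends a finite window to a full sequence by a dummy value outside it; `Φ` and `Ψ` do not see
  -- the dummy values.
  let ext : ∀ (c K : ℕ), ((Finset.Ico c (c + K)) → G) → ℕ → G := fun c K z k =>
    if hk : c + k ∈ Finset.Ico c (c + K) then z ⟨c + k, hk⟩ else g0
  have hext : ∀ c K, Measurable (ext c K) := by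
    intro c K
    refine measurable_pi_lambda _ fun k => ?_
    by_cases hk : c + k ∈ Finset.Ico c (c + K)
    · simp only [ext, hk, dite_true]
      exact measurable_pi_apply _
    · simp only [ext, hk, dite_false]
      exact measurable_const
  have key : ∀ (c K : ℕ) ω, ∀ k ∈ Set.Iio K,
      ext c K (fun i => Y i ω) k = shift c (path Y ω) k := by
    intro c K ω k hk
    have hk' : c + k ∈ Finset.Ico c (c + K) := by
      have : k < K := hk
      simp only [Finset.mem_Ico]; omega
    simp only [ext, hk', dite_true, shift_apply, path_apply]
  have h' := h.comp (hΦ.comp (hext a K)) (hΨ.comp (hext b K'))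
  have e1 : (Φ ∘ ext a K) ∘ (fun ω (i : Finset.Ico a (a + K)) => Y i ω)
      = fun ω => Φ (shift a (path Y ω)) := funext fun ω => hΦK (key a K ω)
  have e2 : (Ψ ∘ ext b K') ∘ (fun ω (i : Finset.Ico b (b + K')) => Y i ω)
      = fun ω => Ψ (shift b (path Y ω)) := funext fun ω => hΨK (key b K' ω)
  rwa [e1, e2] at h'

/-- The strong law of large numbers for functions of consecutive blocks of length `K`. -/
lemma strong_law_blocks [Nonempty G] (hYm : ∀ n, Measurable (Y n)) (hYlaw : ∀ n, P.map (Y n) = μ)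
    (hYind : iIndepFun Y P) {Φ : (ℕ → G) → ℝ} (hΦ : Measurable Φ) {K : ℕ}
    (hΦK : DependsOn Φ (Set.Iio K)) (hint : Integrable (fun ω => Φ (path Y ω)) P) :
    ∀ᵐ ω ∂P, Tendsto (fun n : ℕ => (∑ j ∈ Finset.range n, Φ (shift (j * K) (path Y ω))) / n)
      atTop (𝓝 (∫ ω, Φ (path Y ω) ∂P)) := by
  have hid : ∀ j, IdentDistrib (fun ω => Φ (shift (j * K) (path Y ω)))
      (fun ω => Φ (path Y ω)) P P := fun j => identDistrib_shift hYm hYlaw hYind hΦ (j * K)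
  have h := strong_law_ae_real (μ := P) (fun j ω => Φ (shift (j * K) (path Y ω)))
    ((hid 0).integrable_iff.2 hint) ?_ (fun j => (hid j).trans (hid 0).symm)
  · rwa [(hid 0).integral_eq] at h
  · have aux : ∀ i j : ℕ, i < j → IndepFun (fun ω => Φ (shift (i * K) (path Y ω)))
        (fun ω => Φ (shift (j * K) (path Y ω))) P := fun i j hij =>
      indepFun_shift hYm hYind hΦ hΦ hΦK hΦK (by
        calc i * K + K = (i + 1) * K := by ring
          _ ≤ j * K := Nat.mul_le_mul_right K hij)
    intro i j hij
    rcases lt_or_gt_of_ne hij with h | h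
    · exact aux i j h
    · exact (aux j i h).symm

end Window

/-! ### Functionals of nonnegative matrices -/

section Functionals

variable {d : ℕ}

/-- The smallest entry of a matrix. -/
noncomputable def minEntry (g : Matrix (Fin d) (Fin d) ℝ) : ℝ := ⨅ i, ⨅ j, g i j

/-- The smallest row sum of a matrix. -/
noncomputable def rowMin (g : Matrix (Fin d) (Fin d) ℝ) : ℝ := ⨅ i, ∑ j, g i j

/-- The sum of the entries of a matrix. -/
def entrySum (g : Matrix (Fin d) (Fin d) ℝ) : ℝ := ∑ i, ∑ j, g i j

variable {g h k : Matrix (Fin d) (Fin d) ℝ}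

lemma minEntry_le (g : Matrix (Fin d) (Fin d) ℝ) (i j : Fin d) : minEntry g ≤ g i j :=
  (ciInf_le (Set.finite_range _).bddBelow i).trans (ciInf_le (Set.finite_range _).bddBelow j)

lemma le_minEntry [NeZero d] {c : ℝ} (hc : ∀ i j, c ≤ g i j) : c ≤ minEntry g :=
  le_ciInf fun i => le_ciInf fun j => hc i j

lemma rowMin_le (g : Matrix (Fin d) (Fin d) ℝ) (i : Fin d) : rowMin g ≤ ∑ j, g i j :=
  ciInf_le (Set.finite_range _).bddBelow i

lemma le_rowMin [NeZero d] {c : ℝ} (hc : ∀ i, c ≤ ∑ j, g i j) : c ≤ rowMin g :=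
  le_ciInf hc

lemma minEntry_pos [NeZero d] (hg : ∀ i j, 0 < g i j) : 0 < minEntry g := by
  obtain ⟨i, hi⟩ := exists_eq_ciInf_of_finite (f := fun i => ⨅ j, g i j)
  obtain ⟨j, hj⟩ := exists_eq_ciInf_of_finite (f := fun j => g i j)
  have : minEntry g = g i j := by rw [hj]; exact hi.symm
  rw [this]
  exact hg i j

lemma minEntry_nonneg [NeZero d] (hg : ∀ i j, 0 ≤ g i j) : 0 ≤ minEntry g := le_minEntry hg

lemma minEntry_le_rowMin [NeZero d] (hg : ∀ i j, 0 ≤ g i j) : minEntry g ≤ rowMin g :=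
  le_rowMin fun i => (minEntry_le g i 0).trans
    (Finset.single_le_sum (f := fun j => g i j) (fun j _ => hg i j) (Finset.mem_univ 0))

lemma rowMin_pos [NeZero d] (hg : g ∈ allowable d) : 0 < rowMin g := by
  obtain ⟨i, hi⟩ := exists_eq_ciInf_of_finite (f := fun i => ∑ j, g i j)
  have : rowMin g = ∑ j, g i j := hi.symm
  rw [this]
  obtain ⟨j, hj⟩ := hg.2.1 i
  exact Finset.sum_pos' (fun j _ => hg.1 i j) ⟨j, Finset.mem_univ j, hj⟩

lemma rowSum_le_entrySum (hg : ∀ i j, 0 ≤ g i j) (i : Fin d) : ∑ j, g i j ≤ entrySum g :=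
  Finset.single_le_sum (f := fun i => ∑ j, g i j)
    (fun i _ => Finset.sum_nonneg fun j _ => hg i j) (Finset.mem_univ i)

lemma rowMin_le_entrySum [NeZero d] (hg : ∀ i j, 0 ≤ g i j) : rowMin g ≤ entrySum g :=
  (rowMin_le g 0).trans (rowSum_le_entrySum hg 0)

lemma card_mul_rowMin_le (g : Matrix (Fin d) (Fin d) ℝ) : d * rowMin g ≤ entrySum g := by
  have := Finset.card_nsmul_le_sum Finset.univ (fun i => ∑ j, g i j) (rowMin g)
    fun i _ => rowMin_le g i
  simpa [entrySum] using this

lemma entrySum_nonneg (hg : ∀ i j, 0 ≤ g i j) : 0 ≤ entrySum g :=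
  Finset.sum_nonneg fun i _ => Finset.sum_nonneg fun j _ => hg i j

lemma entrySum_transpose (g : Matrix (Fin d) (Fin d) ℝ) : entrySum gᵀ = entrySum g :=
  Finset.sum_comm

/-- A left factor that need not be positive costs only its smallest row sum: entries of `g * h`
combine entries of `h` with weights from a row of `g`. -/
lemma rowMin_mul_minEntry_le [NeZero d] (hg : ∀ i j, 0 ≤ g i j) (hh : ∀ i j, 0 ≤ h i j) :
    rowMin g * minEntry h ≤ minEntry (g * h) := by
  refine le_minEntry fun i j => ?_
  calc rowMin g * minEntry h ≤ (∑ l, g i l) * minEntry h :=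
        mul_le_mul_of_nonneg_right (rowMin_le g i) (minEntry_nonneg hh)
    _ = ∑ l, g i l * minEntry h := Finset.sum_mul ..
    _ ≤ ∑ l, g i l * h l j :=
        Finset.sum_le_sum fun l _ => mul_le_mul_of_nonneg_left (minEntry_le h l j) (hg i l)
    _ = (g * h) i j := (Matrix.mul_apply ..).symm

lemma rowSum_mul (g h : Matrix (Fin d) (Fin d) ℝ) (i : Fin d) :
    ∑ j, (g * h) i j = ∑ l, g i l * ∑ j, h l j := by
  simp only [Matrix.mul_apply, Finset.mul_sum]
  exact Finset.sum_comm

lemma rowMin_nonneg [NeZero d] (hg : ∀ i j, 0 ≤ g i j) : 0 ≤ rowMin g :=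
  (minEntry_nonneg hg).trans (minEntry_le_rowMin hg)

lemma rowMin_mul_rowMin_le [NeZero d] (hg : ∀ i j, 0 ≤ g i j) (hh : ∀ i j, 0 ≤ h i j) :
    rowMin g * rowMin h ≤ rowMin (g * h) := by
  refine le_rowMin fun i => ?_
  rw [rowSum_mul]
  calc rowMin g * rowMin h ≤ (∑ l, g i l) * rowMin h :=
        mul_le_mul_of_nonneg_right (rowMin_le g i) (rowMin_nonneg hh)
    _ = ∑ l, g i l * rowMin h := Finset.sum_mul ..
    _ ≤ _ := Finset.sum_le_sum fun l _ => mul_le_mul_of_nonneg_left (rowMin_le h l) (hg i l)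

lemma entrySum_mul_le (hg : ∀ i j, 0 ≤ g i j) (hh : ∀ i j, 0 ≤ h i j) :
    entrySum (g * h) ≤ entrySum g * entrySum h := by
  unfold entrySum
  simp only [rowSum_mul, Finset.sum_mul]
  exact Finset.sum_le_sum fun i _ => Finset.sum_le_sum fun l _ =>
    mul_le_mul_of_nonneg_left (rowSum_le_entrySum hh l) (hg i l)

/-- In the double sum for an entry of the product, the outer factors can be bounded below uniformly,
leaving the full sum of the middle one. This turns growth of the norm into growth of the smallest
entry. -/
lemma minEntry_mul_entrySum_mul_minEntry_le [NeZero d] (hg : ∀ i j, 0 ≤ g i j)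
    (hh : ∀ i j, 0 ≤ h i j) (hk : ∀ i j, 0 ≤ k i j) :
    minEntry g * entrySum h * minEntry k ≤ minEntry (g * (h * k)) := by
  refine le_minEntry fun i j => ?_
  have h1 : ∀ l, (∑ m, h l m) * minEntry k ≤ (h * k) l j := fun l => by
    rw [Matrix.mul_apply, Finset.sum_mul]
    exact Finset.sum_le_sum fun m _ => mul_le_mul_of_nonneg_left (minEntry_le k m j) (hh l m)
  calc minEntry g * entrySum h * minEntry k
      = ∑ l, minEntry g * ((∑ m, h l m) * minEntry k) := by
        rw [← Finset.mul_sum, ← Finset.sum_mul, mul_assoc]; rfl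
    _ ≤ ∑ l, g i l * (h * k) l j := Finset.sum_le_sum fun l _ =>
        mul_le_mul (minEntry_le g i l) (h1 l)
          (mul_nonneg (Finset.sum_nonneg fun m _ => hh l m) (minEntry_nonneg hk)) (hg i l)
    _ = _ := (Matrix.mul_apply ..).symm

/-! ### Comparison with norms, coefficients and the spectral radius -/

lemma l1Norm_eq_sum (x : Fin d → ℝ) : l1Norm x = ∑ i, |x i| := by
  simp [l1Norm, PiLp.norm_eq_of_nat (p := 1) 1 (by simp)]

lemma l1Norm_mulVec_le_opNorm (g : Matrix (Fin d) (Fin d) ℝ) (x : Fin d → ℝ) :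
    l1Norm (g *ᵥ x) ≤ opNorm g * l1Norm x :=
  ((Matrix.toLpLin 1 1 g).toContinuousLinearMap).le_opNorm (WithLp.toLp 1 x)

lemma opNorm_le_entrySum (hg : ∀ i j, 0 ≤ g i j) : opNorm g ≤ entrySum g := by
  refine ContinuousLinearMap.opNorm_le_bound _ (entrySum_nonneg hg) fun x => ?_
  have key : l1Norm (g *ᵥ x.ofLp) ≤ entrySum g * l1Norm x.ofLp := by
    simp only [l1Norm_eq_sum]
    unfold entrySum
    rw [Finset.sum_mul]
    refine Finset.sum_le_sum fun i _ => ?_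
    simp only [Matrix.mulVec, dotProduct]
    refine (Finset.abs_sum_le_sum_abs _ _).trans ?_
    rw [Finset.sum_mul]
    refine Finset.sum_le_sum fun j _ => ?_
    rw [abs_mul, abs_of_nonneg (hg i j)]
    exact mul_le_mul_of_nonneg_left
      (Finset.single_le_sum (f := fun j => |x.ofLp j|) (fun _ _ => abs_nonneg _)
        (Finset.mem_univ j)) (hg i j)
  exact key

lemma entrySum_le_card_mul_opNorm (hg : ∀ i j, 0 ≤ g i j) : entrySum g ≤ d * opNorm g := by
  have h := l1Norm_mulVec_le_opNorm g (fun _ => 1)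
  have e : l1Norm (g *ᵥ fun _ => (1 : ℝ)) = entrySum g := by
    rw [l1Norm_eq_sum]
    refine Finset.sum_congr rfl fun i _ => ?_
    simp only [Matrix.mulVec, dotProduct, mul_one]
    exact abs_of_nonneg (Finset.sum_nonneg fun j _ => hg i j)
  rw [e, l1Norm_eq_sum] at h
  simpa [mul_comm] using h

lemma rowMin_le_opNorm [NeZero d] (hg : ∀ i j, 0 ≤ g i j) : rowMin g ≤ opNorm g := by
  have h := (card_mul_rowMin_le g).trans (entrySum_le_card_mul_opNorm hg)
  have hd : (0 : ℝ) < d := by exact_mod_cast Nat.pos_of_ne_zero (NeZero.ne d)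
  exact le_of_mul_le_mul_left h hd

lemma sum_eq_one_of_mem_unitSimplex {x : Fin d → ℝ} (hx : x ∈ unitSimplex d) : ∑ i, x i = 1 := by
  have h := hx.1
  rw [l1Norm_eq_sum] at h
  rw [← h]
  exact Finset.sum_congr rfl fun i _ => (abs_of_nonneg (hx.2 i)).symm

lemma single_mem_unitSimplex (i : Fin d) : Pi.single i 1 ∈ unitSimplex d := by
  refine ⟨?_, fun j => ?_⟩
  · rw [l1Norm_eq_sum, Finset.sum_eq_single i (by simp +contextual) (by simp)]
    simp
  · by_cases h : j = i
    · subst h; simp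
    · simp [h]

lemma le_dotProduct_of_mem_unitSimplex {x a : Fin d → ℝ} {c : ℝ} (hx : x ∈ unitSimplex d)
    (ha : ∀ i, c ≤ a i) : c ≤ x ⬝ᵥ a := by
  calc c = ∑ i, x i * c := by rw [← Finset.sum_mul, sum_eq_one_of_mem_unitSimplex hx, one_mul]
    _ ≤ _ := Finset.sum_le_sum fun i _ => mul_le_mul_of_nonneg_left (ha i) (hx.2 i)

lemma dotProduct_le_of_mem_unitSimplex {x a : Fin d → ℝ} {c : ℝ} (hx : x ∈ unitSimplex d)
    (ha : ∀ i, a i ≤ c) : x ⬝ᵥ a ≤ c := by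
  calc _ ≤ ∑ i, x i * c :=
        Finset.sum_le_sum fun i _ => mul_le_mul_of_nonneg_left (ha i) (hx.2 i)
    _ = c := by rw [← Finset.sum_mul, sum_eq_one_of_mem_unitSimplex hx, one_mul]

lemma minEntry_le_coeff {x y : Fin d → ℝ} (hx : x ∈ unitSimplex d) (hy : y ∈ unitSimplex d) :
    minEntry g ≤ y ⬝ᵥ (g *ᵥ x) := by
  refine le_dotProduct_of_mem_unitSimplex hy fun i => ?_
  rw [Matrix.mulVec, dotProduct_comm]
  exact le_dotProduct_of_mem_unitSimplex hx fun j => minEntry_le g i j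

lemma coeff_le_entrySum (hg : ∀ i j, 0 ≤ g i j) {x y : Fin d → ℝ} (hx : x ∈ unitSimplex d)
    (hy : y ∈ unitSimplex d) : y ⬝ᵥ (g *ᵥ x) ≤ entrySum g := by
  refine dotProduct_le_of_mem_unitSimplex hy fun i => ?_
  rw [Matrix.mulVec, dotProduct_comm]
  exact dotProduct_le_of_mem_unitSimplex hx fun j =>
    (Finset.single_le_sum (f := fun j => g i j) (fun j _ => hg i j) (Finset.mem_univ j)).trans
      (rowSum_le_entrySum hg i)

lemma l1Norm_mulVec (hg : ∀ i j, 0 ≤ g i j) {x : Fin d → ℝ} (hx : x ∈ unitSimplex d) :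
    l1Norm (g *ᵥ x) = x ⬝ᵥ fun j => ∑ i, gᵀ j i := by
  rw [l1Norm_eq_sum]
  simp only [dotProduct, Finset.mul_sum, Matrix.transpose_apply, Matrix.mulVec]
  rw [Finset.sum_comm]
  refine Finset.sum_congr rfl fun i _ => ?_
  rw [abs_of_nonneg (Finset.sum_nonneg fun j _ => mul_nonneg (hg i j) (hx.2 j))]
  exact Finset.sum_congr rfl fun j _ => mul_comm _ _

/-- On the simplex `‖g x‖` is the average of the column sums of `g` with weights `x`, so its infimum
is attained at a vertex. -/
lemma vInf_eq_rowMin_transpose [NeZero d] (hg : ∀ i j, 0 ≤ g i j) : vInf g = rowMin gᵀ := by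
  have : Nonempty (unitSimplex d) := ⟨⟨_, single_mem_unitSimplex 0⟩⟩
  refine le_antisymm (le_rowMin fun i => ?_) (le_ciInf fun x => ?_)
  · refine (ciInf_le ⟨0, ?_⟩ ⟨Pi.single i 1, single_mem_unitSimplex i⟩).trans ?_
    · rintro _ ⟨x, rfl⟩
      exact norm_nonneg _
    · rw [l1Norm_mulVec hg (single_mem_unitSimplex i), single_one_dotProduct]
  · rw [l1Norm_mulVec hg x.2]
    exact le_dotProduct_of_mem_unitSimplex x.2 fun i => rowMin_le gᵀ i

lemma minEntry_le_vInf [NeZero d] (hg : ∀ i j, 0 ≤ g i j) : minEntry g ≤ vInf g := by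
  rw [vInf_eq_rowMin_transpose hg]
  refine le_trans ?_ (minEntry_le_rowMin fun i j => hg j i)
  exact le_minEntry fun i j => minEntry_le g j i

lemma vInf_le_entrySum [NeZero d] (hg : ∀ i j, 0 ≤ g i j) : vInf g ≤ entrySum g := by
  rw [vInf_eq_rowMin_transpose hg, ← entrySum_transpose]
  exact rowMin_le_entrySum fun i j => hg j i

section SpectralRadius

attribute [local instance] Matrix.linftyOpNormedRing Matrix.linftyOpNormedAlgebra

/-- The norm in this section is the largest absolute row sum, an algebra norm to which Gelfand's
formula applies. -/
lemma norm_map_ofReal_le_entrySum (hg : ∀ i j, 0 ≤ g i j) :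
    ‖g.map (algebraMap ℝ ℂ)‖ ≤ entrySum g := by
  rw [Matrix.linfty_opNorm_def]
  have : (Finset.univ.sup fun i => ∑ j, ‖g.map (algebraMap ℝ ℂ) i j‖₊)
      ≤ (⟨entrySum g, entrySum_nonneg hg⟩ : NNReal) := by
    refine Finset.sup_le fun i _ => ?_
    refine NNReal.coe_le_coe.1 ?_
    push_cast
    refine le_trans (le_of_eq ?_) (rowSum_le_entrySum hg i)
    refine Finset.sum_congr rfl fun j _ => ?_
    simp [abs_of_nonneg (hg i j)]
  exact_mod_cast this

lemma rowMin_le_norm_map_ofReal [NeZero d] (hg : ∀ i j, 0 ≤ g i j) :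
    rowMin g ≤ ‖g.map (algebraMap ℝ ℂ)‖ := by
  rw [Matrix.linfty_opNorm_def]
  have h1 : (∑ j, ‖g.map (algebraMap ℝ ℂ) 0 j‖₊)
      ≤ Finset.univ.sup fun i => ∑ j, ‖g.map (algebraMap ℝ ℂ) i j‖₊ :=
    Finset.le_sup (f := fun i => ∑ j, ‖g.map (algebraMap ℝ ℂ) i j‖₊) (Finset.mem_univ 0)
  refine le_trans ?_ (NNReal.coe_le_coe.2 h1)
  push_cast
  refine (rowMin_le g 0).trans (le_of_eq ?_)
  refine Finset.sum_congr rfl fun j _ => ?_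
  simp [abs_of_nonneg (hg 0 j)]

lemma spectralRadius_le_entrySum [NeZero d] (hg : ∀ i j, 0 ≤ g i j) :
    spectralRadius ℂ (g.map (algebraMap ℝ ℂ)) ≤ ENNReal.ofReal (entrySum g) := by
  refine (spectrum.spectralRadius_le_nnnorm _).trans ?_
  rw [← enorm_eq_nnnorm, ← ofReal_norm]
  exact ENNReal.ofReal_le_ofReal (norm_map_ofReal_le_entrySum hg)

lemma specRadius_le_entrySum [NeZero d] (hg : ∀ i j, 0 ≤ g i j) : specRadius g ≤ entrySum g :=
  ENNReal.toReal_le_of_le_ofReal (entrySum_nonneg hg) (spectralRadius_le_entrySum hg)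

lemma pow_rowMin_le [NeZero d] (hg : g ∈ allowable d) (n : ℕ) : rowMin g ^ n ≤ rowMin (g ^ n) := by
  induction n with
  | zero =>
    refine le_rowMin fun i => ?_
    simp [Matrix.one_apply]
  | succ n ih =>
    rw [pow_succ, pow_succ]
    exact (mul_le_mul_of_nonneg_right ih (rowMin_nonneg hg.1)).trans
      (rowMin_mul_rowMin_le (Submonoid.pow_mem _ hg n).1 hg.1)

lemma tendsto_norm_pow_spectralRadius (g : Matrix (Fin d) (Fin d) ℝ) :
    Tendsto (fun n : ℕ => ENNReal.ofReal (‖(g ^ n).map (algebraMap ℝ ℂ)‖ ^ (1 / n : ℝ))) atTop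
      (𝓝 (spectralRadius ℂ (g.map (algebraMap ℝ ℂ)))) := by
  refine (spectrum.pow_norm_pow_one_div_tendsto_nhds_spectralRadius _).congr fun n => ?_
  rw [← Matrix.map_pow]

/-- The smallest row sum is supermultiplicative and bounded by the row-sum norm, so the bound passes
to the limit in Gelfand's formula. It holds even when the matrix has zero entries, which
integrability for every n requires. -/
lemma rowMin_le_specRadius [NeZero d] (hg : g ∈ allowable d) : rowMin g ≤ specRadius g := by
  have h : ENNReal.ofReal (rowMin g) ≤ spectralRadius ℂ (g.map (algebraMap ℝ ℂ)) := by
    refine ge_of_tendsto (tendsto_norm_pow_spectralRadius g) ?_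
    filter_upwards [eventually_gt_atTop 0] with n hn
    refine ENNReal.ofReal_le_ofReal ?_
    calc rowMin g = (rowMin g ^ n) ^ (1 / n : ℝ) := by
          rw [one_div, Real.pow_rpow_inv_natCast (rowMin_pos hg).le hn.ne']
      _ ≤ _ := Real.rpow_le_rpow (pow_nonneg (rowMin_pos hg).le _)
          ((pow_rowMin_le hg n).trans
            (rowMin_le_norm_map_ofReal (Submonoid.pow_mem _ hg n).1)) (by positivity)
  exact (ENNReal.ofReal_le_iff_le_toReal
    (ne_top_of_le_ne_top ENNReal.ofReal_ne_top (spectralRadius_le_entrySum hg.1))).1 h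

/-! ### Measurability -/

lemma measurable_entry (i j : Fin d) :
    Measurable fun g : allowable d => (g : Matrix (Fin d) (Fin d) ℝ) i j := by
  have : Continuous fun g : allowable d => (g : Matrix (Fin d) (Fin d) ℝ) i j :=
    continuous_subtype_val.matrix_elem i j
  exact this.measurable

lemma measurable_minEntry :
    Measurable fun g : allowable d => minEntry (g : Matrix (Fin d) (Fin d) ℝ) :=
  Measurable.iInf fun i => Measurable.iInf fun j => measurable_entry i j

lemma measurable_rowMin :
    Measurable fun g : allowable d => rowMin (g : Matrix (Fin d) (Fin d) ℝ) :=
  Measurable.iInf fun i => Finset.measurable_sum _ fun j _ => measurable_entry i j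

lemma measurable_entrySum :
    Measurable fun g : allowable d => entrySum (g : Matrix (Fin d) (Fin d) ℝ) :=
  Finset.measurable_sum _ fun i _ => Finset.measurable_sum _ fun j _ => measurable_entry i j

lemma measurable_opNorm :
    Measurable fun g : allowable d => opNorm (g : Matrix (Fin d) (Fin d) ℝ) := by
  have h : Continuous fun g : Matrix (Fin d) (Fin d) ℝ =>
      (Matrix.toLpLin 1 1 g).toContinuousLinearMap :=
    LinearMap.continuous_of_finiteDimensional
      ((Matrix.toLpLin 1 1 : Matrix (Fin d) (Fin d) ℝ ≃ₗ[ℝ] _).trans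
        LinearMap.toContinuousLinearMap).toLinearMap
  exact (h.norm.comp continuous_subtype_val).measurable

instance : SecondCountableTopology (allowable d) :=
  haveI : SecondCountableTopology (Matrix (Fin d) (Fin d) ℝ) :=
    inferInstanceAs (SecondCountableTopology (Fin d → Fin d → ℝ))
  TopologicalSpace.Subtype.secondCountableTopology _

instance : MeasurableMul₂ (allowable d) := ContinuousMul.measurableMul₂

lemma measurable_norm_map_ofReal :
    Measurable fun g : allowable d => ‖(g : Matrix (Fin d) (Fin d) ℝ).map (algebraMap ℝ ℂ)‖ := by
  simp only [Matrix.linfty_opNorm_def]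
  refine measurable_coe_nnreal_real.comp ?_
  have h : Measurable ((Finset.univ : Finset (Fin d)).sup fun i (g : allowable d) =>
      ∑ j, ‖(g : Matrix (Fin d) (Fin d) ℝ).map (algebraMap ℝ ℂ) i j‖₊) := by
    refine Finset.sup_induction measurable_const (fun _ h₁ _ h₂ => h₁.sup h₂) fun i _ => ?_
    exact Finset.measurable_fun_sum _ fun j _ =>
      (Complex.measurable_ofReal.comp (measurable_entry i j)).nnnorm
  convert h using 1
  funext g
  rw [Finset.sup_apply]

/-- By Gelfand's formula the spectral radius is a pointwise limit of measurable functions of the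
powers. -/
lemma measurable_specRadius :
    Measurable fun g : allowable d => specRadius (g : Matrix (Fin d) (Fin d) ℝ) := by
  have h : ∀ n : ℕ, Measurable fun g : allowable d => ENNReal.ofReal
      (‖((g ^ n : allowable d) : Matrix (Fin d) (Fin d) ℝ).map (algebraMap ℝ ℂ)‖ ^ (1 / n : ℝ)) :=
    fun n => ENNReal.measurable_ofReal.comp
      ((measurable_norm_map_ofReal.comp (measurable_id.pow_const n)).pow_const _)
  have h' : Measurable fun g : allowable d =>
      spectralRadius ℂ ((g : Matrix (Fin d) (Fin d) ℝ).map (algebraMap ℝ ℂ)) :=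
    measurable_of_tendsto_metrizable h (tendsto_pi_nhds.2 fun g : allowable d =>
      tendsto_norm_pow_spectralRadius (g : Matrix (Fin d) (Fin d) ℝ))
  exact h'.ennreal_toReal

lemma measurable_transpose : Measurable (transpose : allowable d → allowable d) :=
  (Continuous.subtype_mk (continuous_subtype_val.matrix_transpose) _).measurable

end SpectralRadius

end Functionals

/-! ### Products along a sequence -/

section SeqProd

variable {d : ℕ}

/-- The product `y (n - 1) * ⋯ * y 0`. -/
def seqProd (y : ℕ → allowable d) : ℕ → allowable d
  | 0 => 1
  | n + 1 => y n * seqProd y n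

lemma leftProd_eq_seqProd {Ω : Type*} (Y : ℕ → Ω → allowable d) (n : ℕ) (ω : Ω) :
    leftProd Y n ω = seqProd (path Y ω) n := by
  induction n with
  | zero => rfl
  | succ n ih => simp only [leftProd, seqProd, ih, path_apply]

lemma seqProd_add (y : ℕ → allowable d) (a n : ℕ) :
    seqProd y (a + n) = seqProd (shift a y) n * seqProd y a := by
  induction n with
  | zero => simp [seqProd]
  | succ n ih => rw [← add_assoc, seqProd, seqProd, ih, mul_assoc, shift_apply]

lemma seqProd_congr {y y' : ℕ → allowable d} {n : ℕ} (h : ∀ k < n, y k = y' k) :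
    seqProd y n = seqProd y' n := by
  induction n with
  | zero => rfl
  | succ n ih =>
    rw [seqProd, seqProd, h n n.lt_succ_self, ih fun k hk => h k (hk.trans n.lt_succ_self)]

lemma measurable_seqProd (n : ℕ) : Measurable fun y : ℕ → allowable d => seqProd y n := by
  induction n with
  | zero => exact measurable_const
  | succ n ih => exact (measurable_pi_apply n).mul ih

/-- The size `|log r| + |log s|` of a matrix, where `r` is the smallest row sum and `s` the sum of
the entries. -/
noncomputable def logSize (g : Matrix (Fin d) (Fin d) ℝ) : ℝ :=
  |Real.log (rowMin g)| + |Real.log (entrySum g)|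

lemma logSize_nonneg (g : Matrix (Fin d) (Fin d) ℝ) : 0 ≤ logSize g := by
  unfold logSize; positivity

lemma measurable_logSize :
    Measurable fun g : allowable d => logSize (g : Matrix (Fin d) (Fin d) ℝ) :=
  (continuous_abs.measurable.comp (Real.measurable_log.comp measurable_rowMin)).add
    (continuous_abs.measurable.comp (Real.measurable_log.comp measurable_entrySum))

variable [NeZero d]

lemma entrySum_pos (g : allowable d) : 0 < entrySum (g : Matrix (Fin d) (Fin d) ℝ) :=
  (rowMin_pos g.2).trans_le (rowMin_le_entrySum g.2.1)

lemma log_entrySum_mul_le (g h : allowable d) :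
    Real.log (entrySum ((g * h : allowable d) : Matrix (Fin d) (Fin d) ℝ)) ≤
      Real.log (entrySum (g : Matrix (Fin d) (Fin d) ℝ)) +
        Real.log (entrySum (h : Matrix (Fin d) (Fin d) ℝ)) := by
  rw [← Real.log_mul (entrySum_pos g).ne' (entrySum_pos h).ne']
  exact Real.log_le_log (entrySum_pos _) (entrySum_mul_le g.2.1 h.2.1)

lemma le_log_rowMin_mul (g h : allowable d) :
    Real.log (rowMin (g : Matrix (Fin d) (Fin d) ℝ)) +
        Real.log (rowMin (h : Matrix (Fin d) (Fin d) ℝ)) ≤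
      Real.log (rowMin ((g * h : allowable d) : Matrix (Fin d) (Fin d) ℝ)) := by
  rw [← Real.log_mul (rowMin_pos g.2).ne' (rowMin_pos h.2).ne']
  exact Real.log_le_log (mul_pos (rowMin_pos g.2) (rowMin_pos h.2))
    (rowMin_mul_rowMin_le g.2.1 h.2.1)

lemma le_log_minEntry_mul (g h : allowable d)
    (hh : 0 < minEntry (h : Matrix (Fin d) (Fin d) ℝ)) :
    Real.log (rowMin (g : Matrix (Fin d) (Fin d) ℝ)) +
        Real.log (minEntry (h : Matrix (Fin d) (Fin d) ℝ)) ≤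
      Real.log (minEntry ((g * h : allowable d) : Matrix (Fin d) (Fin d) ℝ)) := by
  rw [← Real.log_mul (rowMin_pos g.2).ne' hh.ne']
  exact Real.log_le_log (mul_pos (rowMin_pos g.2) hh) (rowMin_mul_minEntry_le g.2.1 h.2.1)

lemma minEntry_mul_pos (g h : allowable d) (hh : 0 < minEntry (h : Matrix (Fin d) (Fin d) ℝ)) :
    0 < minEntry ((g * h : allowable d) : Matrix (Fin d) (Fin d) ℝ) :=
  (mul_pos (rowMin_pos g.2) hh).trans_le (rowMin_mul_minEntry_le g.2.1 h.2.1)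

lemma minEntry_pos_mul (g h : allowable d) (hg : 0 < minEntry (g : Matrix (Fin d) (Fin d) ℝ)) :
    0 < minEntry ((g * h : allowable d) : Matrix (Fin d) (Fin d) ℝ) := by
  refine minEntry_pos fun i j => ?_
  obtain ⟨k, hk⟩ := h.2.2.2 j
  have : ((g * h : allowable d) : Matrix (Fin d) (Fin d) ℝ) i j
      = ∑ l, (g : Matrix (Fin d) (Fin d) ℝ) i l * (h : Matrix (Fin d) (Fin d) ℝ) l j :=
    Matrix.mul_apply ..
  rw [this]
  exact Finset.sum_pos' (fun l _ => mul_nonneg (g.2.1 i l) (h.2.1 l j))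
    ⟨k, Finset.mem_univ k, mul_pos (hg.trans_le (minEntry_le _ i k)) hk⟩

lemma rowMin_one : rowMin ((1 : allowable d) : Matrix (Fin d) (Fin d) ℝ) = 1 := by
  simp [rowMin, Matrix.one_apply]

lemma neg_sum_le_log_rowMin_seqProd (y : ℕ → allowable d) (n : ℕ) :
    -∑ k ∈ Finset.range n, |Real.log (rowMin (y k : Matrix (Fin d) (Fin d) ℝ))| ≤
      Real.log (rowMin (seqProd y n : Matrix (Fin d) (Fin d) ℝ)) := by
  induction n with
  | zero => rw [seqProd, rowMin_one]; simp
  | succ n ih =>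
    have h := le_log_rowMin_mul (y n) (seqProd y n)
    have h' := neg_abs_le (Real.log (rowMin (y n : Matrix (Fin d) (Fin d) ℝ)))
    rw [Finset.sum_range_succ, seqProd]
    linarith

/-- The empty product is excluded: its sum of entries is `d`, whereas the right-hand side is zero.
-/
lemma log_entrySum_seqProd_le (y : ℕ → allowable d) {n : ℕ} (hn : 1 ≤ n) :
    Real.log (entrySum (seqProd y n : Matrix (Fin d) (Fin d) ℝ)) ≤
      ∑ k ∈ Finset.range n, |Real.log (entrySum (y k : Matrix (Fin d) (Fin d) ℝ))| := by
  induction n, hn using Nat.le_induction with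
  | base => simpa [seqProd] using le_abs_self _
  | succ n hn ih =>
    have h := log_entrySum_mul_le (y n) (seqProd y n)
    have h' := le_abs_self (Real.log (entrySum (y n : Matrix (Fin d) (Fin d) ℝ)))
    rw [Finset.sum_range_succ, seqProd]
    linarith

lemma abs_log_le_sum_logSize (y : ℕ → allowable d) {n : ℕ} (hn : 1 ≤ n) {t : ℝ}
    (h1 : rowMin (seqProd y n : Matrix (Fin d) (Fin d) ℝ) ≤ t)
    (h2 : t ≤ entrySum (seqProd y n : Matrix (Fin d) (Fin d) ℝ)) :
    |Real.log t| ≤ ∑ k ∈ Finset.range n, logSize (y k : Matrix (Fin d) (Fin d) ℝ) := by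
  have hr := rowMin_pos (seqProd y n).2
  have l1 := Real.log_le_log hr h1
  have l2 := Real.log_le_log (hr.trans_le h1) h2
  have b1 := neg_sum_le_log_rowMin_seqProd y n
  have b2 := log_entrySum_seqProd_le y hn
  have n1 : 0 ≤ ∑ k ∈ Finset.range n, |Real.log (rowMin (y k : Matrix (Fin d) (Fin d) ℝ))| :=
    Finset.sum_nonneg fun _ _ => abs_nonneg _
  have n2 : 0 ≤ ∑ k ∈ Finset.range n, |Real.log (entrySum (y k : Matrix (Fin d) (Fin d) ℝ))| :=
    Finset.sum_nonneg fun _ _ => abs_nonneg _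
  simp only [logSize, Finset.sum_add_distrib]
  rw [abs_le]
  constructor <;> linarith

/-- A lower bound for the growth of the logarithm of the smallest entry under multiplication by
`L + R` matrices, the last `R` of which mix well outside of a rare event. -/
noncomputable def cycleBound (L R : ℕ) (ε : ℝ) (y : ℕ → allowable d) : ℝ :=
  Real.log ε + Real.log (entrySum (seqProd y L : Matrix (Fin d) (Fin d) ℝ))
    - {z : ℕ → allowable d | minEntry (seqProd z R : Matrix (Fin d) (Fin d) ℝ) < ε}.indicator 1
        (shift L y) * ∑ k ∈ Finset.range L, logSize (y k : Matrix (Fin d) (Fin d) ℝ)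
    - ∑ k ∈ Finset.range R, logSize (y (L + k) : Matrix (Fin d) (Fin d) ℝ)

/-- Two cases, according to whether the window of the last `R` matrices mixes well. -/
lemma cycleBound_add_le {L R : ℕ} (hL : 1 ≤ L) {ε : ℝ} (hε : 0 < ε) (hε1 : ε ≤ 1)
    (y : ℕ → allowable d) (A : allowable d) (hA : 0 < minEntry (A : Matrix (Fin d) (Fin d) ℝ)) :
    cycleBound L R ε y + Real.log (minEntry (A : Matrix (Fin d) (Fin d) ℝ)) ≤
      Real.log (minEntry ((seqProd y (L + R) * A : allowable d) : Matrix (Fin d) (Fin d) ℝ)) := by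
  have hZL : 0 ≤ ∑ k ∈ Finset.range L, logSize (y k : Matrix (Fin d) (Fin d) ℝ) :=
    Finset.sum_nonneg fun k _ => logSize_nonneg _
  have hZR : 0 ≤ ∑ k ∈ Finset.range R, logSize (y (L + k) : Matrix (Fin d) (Fin d) ℝ) :=
    Finset.sum_nonneg fun k _ => logSize_nonneg _
  unfold cycleBound
  by_cases hgood : minEntry (seqProd (shift L y) R : Matrix (Fin d) (Fin d) ℝ) < ε
  · have hlogε : Real.log ε ≤ 0 := Real.log_nonpos hε.le hε1
    -- Bad window: `log ε` is nonpositive and the subtracted `logSize` sum over the first `L`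
    -- matrices absorbs `log (entrySum _)`. What remains lies below the row-sum bound for all `L +
    -- R` matrices; the last sum in `cycleBound` pays for the mixing window.
    rw [Set.indicator_of_mem (by exact hgood)]
    have b0 := le_log_minEntry_mul (seqProd y (L + R)) A hA
    have b1 := neg_sum_le_log_rowMin_seqProd y (L + R)
    have b2 := log_entrySum_seqProd_le y hL
    rw [Finset.sum_range_add] at b1
    have n2 : 0 ≤ ∑ k ∈ Finset.range R,
        |Real.log (entrySum (y (L + k) : Matrix (Fin d) (Fin d) ℝ))| :=
      Finset.sum_nonneg fun _ _ => abs_nonneg _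
    simp only [logSize, Finset.sum_add_distrib, Pi.one_apply]
    linarith
  · rw [Set.indicator_of_notMem (by exact hgood), zero_mul, sub_zero]
    rw [not_lt] at hgood
    have h := minEntry_mul_entrySum_mul_minEntry_le (seqProd (shift L y) R).2.1
      (seqProd y L).2.1 A.2.1
    have hpos : 0 < ε * entrySum (seqProd y L : Matrix (Fin d) (Fin d) ℝ) *
        minEntry (A : Matrix (Fin d) (Fin d) ℝ) := mul_pos (mul_pos hε (entrySum_pos _)) hA
    have h2 : ε * entrySum (seqProd y L : Matrix (Fin d) (Fin d) ℝ) *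
        minEntry (A : Matrix (Fin d) (Fin d) ℝ) ≤
        minEntry ((seqProd y (L + R) * A : allowable d) : Matrix (Fin d) (Fin d) ℝ) := by
      rw [seqProd_add, mul_assoc (seqProd (shift L y) R)]
      exact (mul_le_mul_of_nonneg_right (mul_le_mul_of_nonneg_right hgood (entrySum_pos _).le)
        hA.le).trans h
    have h3 := Real.log_le_log hpos h2
    rw [Real.log_mul (mul_pos hε (entrySum_pos _)).ne' hA.ne',
      Real.log_mul hε.ne' (entrySum_pos _).ne'] at h3
    linarith

omit [NeZero d] in
lemma dependsOn_cycleBound (L R : ℕ) (ε : ℝ) :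
    DependsOn (cycleBound (d := d) L R ε) (Set.Iio (L + R)) := by
  intro y y' h
  have h1 : ∀ k < L, y k = y' k := fun k hk => h k (by simp only [Set.mem_Iio]; omega)
  have h2 : ∀ k < R, shift L y k = shift L y' k := fun k hk =>
    h (L + k) (by simp only [Set.mem_Iio]; omega)
  have e1 : ∑ k ∈ Finset.range L, logSize (y k : Matrix (Fin d) (Fin d) ℝ)
      = ∑ k ∈ Finset.range L, logSize (y' k : Matrix (Fin d) (Fin d) ℝ) :=
    Finset.sum_congr rfl fun k hk => by rw [h1 k (Finset.mem_range.1 hk)]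
  have e2 : ∑ k ∈ Finset.range R, logSize (y (L + k) : Matrix (Fin d) (Fin d) ℝ)
      = ∑ k ∈ Finset.range R, logSize (y' (L + k) : Matrix (Fin d) (Fin d) ℝ) :=
    Finset.sum_congr rfl fun k hk => by
      have h3 : y (L + k) = y' (L + k) := h2 k (Finset.mem_range.1 hk)
      rw [h3]
  unfold cycleBound
  rw [seqProd_congr h1, e1, e2]
  simp only [Set.indicator, Set.mem_ofPred_eq, seqProd_congr h2]
  rfl

omit [NeZero d] in
lemma measurableSet_minEntry_seqProd_lt (R : ℕ) (ε : ℝ) : MeasurableSet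
    {z : ℕ → allowable d | minEntry (seqProd z R : Matrix (Fin d) (Fin d) ℝ) < ε} :=
  (measurable_minEntry.comp (measurable_seqProd R)) measurableSet_Iio

omit [NeZero d] in
lemma measurable_sum_logSize (n : ℕ) : Measurable fun y : ℕ → allowable d =>
    ∑ k ∈ Finset.range n, logSize (y k : Matrix (Fin d) (Fin d) ℝ) :=
  Finset.measurable_fun_sum _ fun k _ => measurable_logSize.comp (measurable_pi_apply k)

omit [NeZero d] in
lemma measurable_log_entrySum_seqProd (n : ℕ) : Measurable fun y : ℕ → allowable d =>
    Real.log (entrySum (seqProd y n : Matrix (Fin d) (Fin d) ℝ)) :=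
  Real.measurable_log.comp (measurable_entrySum.comp (measurable_seqProd n))

omit [NeZero d] in
lemma measurable_cycleBound (L R : ℕ) (ε : ℝ) : Measurable (cycleBound (d := d) L R ε) := by
  have h1 : Measurable fun y : ℕ → allowable d =>
      {z : ℕ → allowable d | minEntry (seqProd z R : Matrix (Fin d) (Fin d) ℝ) < ε}.indicator
        (1 : (ℕ → allowable d) → ℝ) (shift L y) :=
    (measurable_one.indicator (measurableSet_minEntry_seqProd_lt R ε)).comp (measurable_shift L)
  have h2 : Measurable fun y : ℕ → allowable d =>
      ∑ k ∈ Finset.range R, logSize (y (L + k) : Matrix (Fin d) (Fin d) ℝ) :=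
    (measurable_sum_logSize R).comp (measurable_shift L)
  exact (((measurable_log_entrySum_seqProd L).const_add _).sub
    (h1.mul (measurable_sum_logSize L))).sub h2

end SeqProd

/-! ### Random products -/

section Moment

variable {d : ℕ} [NeZero d]

/-- The smallest row sum is `vInf` of the transpose, and the sum of entries is at most `d` times the
operator norm of the transpose. Both logarithms are thus controlled by `bigN`. -/
lemma logSize_le_log_bigN (g : allowable d) :
    logSize (g : Matrix (Fin d) (Fin d) ℝ) ≤
      2 * Real.log (bigN (transpose g : Matrix (Fin d) (Fin d) ℝ)) + Real.log d := by
  have hd : (0 : ℝ) < d := by exact_mod_cast Nat.pos_of_ne_zero (NeZero.ne d)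
  have hr := rowMin_pos g.2
  have hs := entrySum_pos g
  set N := bigN (transpose g : Matrix (Fin d) (Fin d) ℝ) with hN
  have hv : vInf (transpose g : Matrix (Fin d) (Fin d) ℝ) =
      rowMin (g : Matrix (Fin d) (Fin d) ℝ) := by
    rw [vInf_eq_rowMin_transpose (transpose g).2.1]; rfl
  have h1 : 1 / rowMin (g : Matrix (Fin d) (Fin d) ℝ) ≤ N := by
    rw [← hv]; exact le_max_right _ _
  have h2 : entrySum (g : Matrix (Fin d) (Fin d) ℝ) ≤ d * N := by
    rw [← entrySum_transpose]
    exact (entrySum_le_card_mul_opNorm (transpose g).2.1).trans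
      (mul_le_mul_of_nonneg_left (le_max_left _ _) hd.le)
  have h3 : rowMin (g : Matrix (Fin d) (Fin d) ℝ) ≤ N :=
    le_of_mul_le_mul_left ((card_mul_rowMin_le _).trans h2) hd
  have hNpos : 0 < N := hr.trans_le h3
  have l1 := Real.log_le_log (one_div_pos.2 hr) h1
  rw [one_div, Real.log_inv] at l1
  have l2 := Real.log_le_log hs h2
  rw [Real.log_mul hd.ne' hNpos.ne'] at l2
  have l3 := Real.log_le_log hr h3
  have l4 := Real.log_le_log hr (rowMin_le_entrySum g.2.1)
  have l5 : 0 ≤ Real.log d :=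
    Real.log_nonneg (by exact_mod_cast Nat.pos_of_ne_zero (NeZero.ne d))
  have a1 : |Real.log (rowMin (g : Matrix (Fin d) (Fin d) ℝ))| ≤ Real.log N :=
    abs_le.2 ⟨by linarith, l3⟩
  have a2 : |Real.log (entrySum (g : Matrix (Fin d) (Fin d) ℝ))| ≤ Real.log N + Real.log d :=
    abs_le.2 ⟨by linarith, by linarith⟩
  unfold logSize
  linarith

lemma integrable_logSize {μ : Measure (allowable d)} [IsProbabilityMeasure μ]
    (hmom : HasMoment (μ.map transpose) 1) :
    Integrable (fun g : allowable d => logSize (g : Matrix (Fin d) (Fin d) ℝ)) μ := by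
  refine ⟨measurable_logSize.aestronglyMeasurable, ?_⟩
  have hmom' : ∫⁻ g : allowable d, ENNReal.ofReal
      (Real.log (bigN (transpose g : Matrix (Fin d) (Fin d) ℝ))) ∂μ < ⊤ := by
    -- Transposition is a measurable involution, so the lower integral can be transported without
    -- knowing that `bigN` is measurable.
    let e : allowable d ≃ᵐ allowable d := MeasurableEquiv.ofInvolutive transpose
      (fun g => Subtype.ext (Matrix.transpose_transpose _)) measurable_transpose
    have h : HasMoment (μ.map e) 1 := hmom
    unfold HasMoment at h
    rw [lintegral_map_equiv] at h
    simp only [Real.rpow_one] at h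
    exact h
  calc ∫⁻ g : allowable d, ‖logSize (g : Matrix (Fin d) (Fin d) ℝ)‖ₑ ∂μ
      ≤ ∫⁻ g : allowable d, (2 * ENNReal.ofReal
          (Real.log (bigN (transpose g : Matrix (Fin d) (Fin d) ℝ)))
          + ENNReal.ofReal (Real.log d)) ∂μ := by
        refine lintegral_mono fun g => ?_
        rw [Real.enorm_of_nonneg (logSize_nonneg _)]
        refine (ENNReal.ofReal_le_ofReal (logSize_le_log_bigN g)).trans ?_
        refine ENNReal.ofReal_add_le.trans (le_of_eq ?_)
        rw [ENNReal.ofReal_mul (by norm_num), ENNReal.ofReal_ofNat]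
    _ = 2 * ∫⁻ g : allowable d, ENNReal.ofReal
          (Real.log (bigN (transpose g : Matrix (Fin d) (Fin d) ℝ))) ∂μ
          + ENNReal.ofReal (Real.log d) := by
        rw [lintegral_add_right _ measurable_const, lintegral_const_mul' _ _ (by norm_num)]
        simp
    _ < ⊤ := ENNReal.add_lt_top.2 ⟨ENNReal.mul_lt_top (by norm_num) hmom', ENNReal.ofReal_lt_top⟩

end Moment

/-! ### Laws and expectations of the random products -/

section Random

variable {d : ℕ} {μ : Measure (allowable d)} {Ω : Type*} [MeasurableSpace Ω]
  {P : Measure Ω} {Y : ℕ → Ω → allowable d}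

lemma map_seqProd_path [IsProbabilityMeasure P] (hYm : ∀ n, Measurable (Y n)) (hYlaw : ∀ n, P.map (Y n) = μ)
    (hYind : iIndepFun Y P) (n : ℕ) :
    P.map (fun ω => seqProd (path Y ω) n) = convPow μ n := by
  induction n with
  | zero => simp [seqProd, convPow]
  | succ n ih =>
    have h := indepFun_shift (Φ := fun y => seqProd y n) (Ψ := fun y => y 0) hYm hYind
      (measurable_seqProd n) (measurable_pi_apply 0) (a := 0) (b := n) (K := n) (K' := 1)
      (fun y y' h => seqProd_congr h) (fun y y' h => h 0 (by simp)) (by simp)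
    simp only [shift_zero, shift_apply, path_apply, add_zero] at h
    have h' := h.symm.map_mul_eq_map_mconv_map (hYm n)
      ((measurable_seqProd n).comp (measurable_path hYm))
    rw [hYlaw] at h'
    exact h'.trans (congrArg (Measure.mconv μ) ih)

lemma integrable_logSize_path (hYm : ∀ n, Measurable (Y n)) (hYlaw : ∀ n, P.map (Y n) = μ)
    (hZ : Integrable (fun g : allowable d => logSize (g : Matrix (Fin d) (Fin d) ℝ)) μ) (k : ℕ) :
    Integrable (fun ω => logSize (Y k ω : Matrix (Fin d) (Fin d) ℝ)) P := by
  rw [← hYlaw k] at hZ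
  exact hZ.comp_measurable (hYm k)

lemma integral_logSize_path (hYm : ∀ n, Measurable (Y n)) (hYlaw : ∀ n, P.map (Y n) = μ) (k : ℕ) :
    ∫ ω, logSize (Y k ω : Matrix (Fin d) (Fin d) ℝ) ∂P
      = ∫ g : allowable d, logSize (g : Matrix (Fin d) (Fin d) ℝ) ∂μ := by
  rw [← hYlaw k, integral_map (hYm k).aemeasurable measurable_logSize.aestronglyMeasurable]

lemma integral_sum_logSize_path (hYm : ∀ n, Measurable (Y n)) (hYlaw : ∀ n, P.map (Y n) = μ)
    (hZ : Integrable (fun g : allowable d => logSize (g : Matrix (Fin d) (Fin d) ℝ)) μ)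
    (a n : ℕ) :
    ∫ ω, ∑ k ∈ Finset.range n, logSize (Y (a + k) ω : Matrix (Fin d) (Fin d) ℝ) ∂P
      = n * ∫ g : allowable d, logSize (g : Matrix (Fin d) (Fin d) ℝ) ∂μ := by
  rw [integral_finsetSum _ fun _ _ => integrable_logSize_path hYm hYlaw hZ _]
  simp [integral_logSize_path hYm hYlaw]

lemma integrable_sum_logSize_path (hYm : ∀ n, Measurable (Y n)) (hYlaw : ∀ n, P.map (Y n) = μ)
    (hZ : Integrable (fun g : allowable d => logSize (g : Matrix (Fin d) (Fin d) ℝ)) μ)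
    (a n : ℕ) :
    Integrable (fun ω => ∑ k ∈ Finset.range n,
      logSize (Y (a + k) ω : Matrix (Fin d) (Fin d) ℝ)) P :=
  integrable_finsetSum _ fun _ _ => integrable_logSize_path hYm hYlaw hZ _

variable [NeZero d] [IsProbabilityMeasure P]

/-- Any quantity between the smallest row sum and the sum of the entries of a random product has an
integrable logarithm. -/
lemma integrable_log_seqProd (hYm : ∀ n, Measurable (Y n)) (hYlaw : ∀ n, P.map (Y n) = μ)
    (hZ : Integrable (fun g : allowable d => logSize (g : Matrix (Fin d) (Fin d) ℝ)) μ)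
    {f : allowable d → ℝ} (hf : Measurable f)
    (hf1 : ∀ g : allowable d, rowMin (g : Matrix (Fin d) (Fin d) ℝ) ≤ f g)
    (hf2 : ∀ g : allowable d, f g ≤ entrySum (g : Matrix (Fin d) (Fin d) ℝ)) (n : ℕ) :
    Integrable (fun ω => Real.log (f (seqProd (path Y ω) n))) P := by
  rcases Nat.eq_zero_or_pos n with rfl | hn
  · exact integrable_const (Real.log (f 1))
  · have h := integrable_sum_logSize_path hYm hYlaw hZ 0 n
    refine h.mono' (Real.measurable_log.comp (hf.comp
      ((measurable_seqProd n).comp (measurable_path hYm)))).aestronglyMeasurable ?_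
    filter_upwards with ω
    simp only [zero_add]
    exact abs_log_le_sum_logSize (path Y ω) hn (hf1 _) (hf2 _)

lemma integrable_log_entrySum_seqProd (hYm : ∀ n, Measurable (Y n))
    (hYlaw : ∀ n, P.map (Y n) = μ)
    (hZ : Integrable (fun g : allowable d => logSize (g : Matrix (Fin d) (Fin d) ℝ)) μ) (n : ℕ) :
    Integrable (fun ω =>
      Real.log (entrySum (seqProd (path Y ω) n : Matrix (Fin d) (Fin d) ℝ))) P :=
  integrable_log_seqProd hYm hYlaw hZ measurable_entrySum (fun g => rowMin_le_entrySum g.2.1)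
    (fun _ => le_rfl) n

/-- The normalized expectations of `log s(Aₙ)`, with `s` the sum of the entries, converge to the
Lyapunov exponent. -/
lemma tendsto_integral_log_entrySum (hYm : ∀ n, Measurable (Y n)) (hYlaw : ∀ n, P.map (Y n) = μ)
    (hYind : iIndepFun Y P)
    (hZ : Integrable (fun g : allowable d => logSize (g : Matrix (Fin d) (Fin d) ℝ)) μ) :
    Tendsto (fun n : ℕ =>
      (∫ ω, Real.log (entrySum (seqProd (path Y ω) n : Matrix (Fin d) (Fin d) ℝ)) ∂P) / n)
      atTop (𝓝 (lyapunov μ)) := by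
  set u : ℕ → ℝ := fun n =>
    ∫ ω, Real.log (entrySum (seqProd (path Y ω) n : Matrix (Fin d) (Fin d) ℝ)) ∂P with hu
  have hint := integrable_log_entrySum_seqProd hYm hYlaw hZ
  have hsub : Subadditive u := by
    intro m n
    have hid := identDistrib_shift hYm hYlaw hYind (measurable_log_entrySum_seqProd (d := d) n) m
    calc u (m + n) ≤ ∫ ω, (Real.log (entrySum
            (seqProd (shift m (path Y ω)) n : Matrix (Fin d) (Fin d) ℝ))
          + Real.log (entrySum (seqProd (path Y ω) m : Matrix (Fin d) (Fin d) ℝ))) ∂P := by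
          refine integral_mono (hint _) ((hid.integrable_iff.2 (hint n)).add (hint m)) fun ω => ?_
          simp only [seqProd_add]
          exact log_entrySum_mul_le _ _
      _ = u m + u n := by
          rw [integral_add (hid.integrable_iff.2 (hint n)) (hint m), hid.integral_eq, add_comm]
  set z := ∫ g : allowable d, logSize (g : Matrix (Fin d) (Fin d) ℝ) ∂μ with hz
  have hz0 : 0 ≤ z := integral_nonneg fun g => logSize_nonneg _
  -- The bound by the mean of `logSize` makes the limit in Fekete's lemma a real number.
  have hbdd : BddBelow (Set.range fun n => u n / n) := by
    refine ⟨-z, ?_⟩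
    rintro _ ⟨n, rfl⟩
    rcases Nat.eq_zero_or_pos n with rfl | hn
    · simpa using hz0
    · have hn' : (0 : ℝ) < n := by exact_mod_cast hn
      simp only
      rw [le_div_iff₀ hn']
      have e := integral_sum_logSize_path hYm hYlaw hZ 0 n
      have h : ∫ ω, -∑ k ∈ Finset.range n, logSize (Y (0 + k) ω : Matrix (Fin d) (Fin d) ℝ) ∂P
          ≤ u n := by
        refine integral_mono (integrable_sum_logSize_path hYm hYlaw hZ 0 n).neg (hint n)
          fun ω => ?_
        have := abs_log_le_sum_logSize (path Y ω) hn (rowMin_le_entrySum (seqProd _ n).2.1) le_rfl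
        simpa using (abs_le.1 this).1
      rw [integral_neg, e] at h
      linarith
  have hlim := hsub.tendsto_lim hbdd
  have hop : ∀ n, ∫ g : allowable d, Real.log (opNorm (g : Matrix (Fin d) (Fin d) ℝ)) ∂(convPow μ n)
      = ∫ ω, Real.log (opNorm (seqProd (path Y ω) n : Matrix (Fin d) (Fin d) ℝ)) ∂P := fun n => by
    rw [← map_seqProd_path hYm hYlaw hYind n]
    exact integral_map ((measurable_seqProd n).comp (measurable_path hYm)).aemeasurable
      (Real.measurable_log.comp measurable_opNorm).aestronglyMeasurable
  have hintop := integrable_log_seqProd hYm hYlaw hZ measurable_opNorm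
    (fun g => rowMin_le_opNorm g.2.1) (fun g => opNorm_le_entrySum g.2.1)
  have hd : (0 : ℝ) < d := by exact_mod_cast Nat.pos_of_ne_zero (NeZero.ne d)
  -- Operator norm and sum of entries differ by a factor at most `d`, hence the limit defining
  -- `lyapunov` exists and agrees with the subadditive one.
  have hlim2 : Tendsto (fun n : ℕ =>
      (∫ g : allowable d, Real.log (opNorm (g : Matrix (Fin d) (Fin d) ℝ)) ∂(convPow μ n)) / (n : ℝ))
      atTop (𝓝 hsub.lim) := by
    have hlow : Tendsto (fun n : ℕ => u n / n - Real.log d / n) atTop (𝓝 (hsub.lim - 0)) :=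
      hlim.sub (tendsto_const_div_atTop_nhds_zero_nat _)
    rw [sub_zero] at hlow
    refine tendsto_of_tendsto_of_tendsto_of_le_of_le hlow hlim (fun n => ?_) (fun n => ?_)
    · simp only [hop, ← sub_div]
      refine div_le_div_of_nonneg_right ?_ (Nat.cast_nonneg n)
      have : u n - Real.log d = ∫ ω, (Real.log (entrySum
          (seqProd (path Y ω) n : Matrix (Fin d) (Fin d) ℝ)) - Real.log d) ∂P := by
        rw [integral_sub (hint n) (integrable_const _)]; simp [hu]
      rw [this]
      refine integral_mono ((hint n).sub (integrable_const _)) (hintop n) fun ω => ?_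
      have hpos : 0 < opNorm (seqProd (path Y ω) n : Matrix (Fin d) (Fin d) ℝ) :=
        (rowMin_pos (seqProd _ n).2).trans_le (rowMin_le_opNorm (seqProd _ n).2.1)
      have h := Real.log_le_log (entrySum_pos _)
        (entrySum_le_card_mul_opNorm (seqProd (path Y ω) n).2.1)
      rw [Real.log_mul hd.ne' hpos.ne'] at h
      simp only
      linarith
    · simp only [hop]
      refine div_le_div_of_nonneg_right ?_ (Nat.cast_nonneg n)
      refine integral_mono (hintop n) (hint n) fun ω => ?_
      have hpos : 0 < opNorm (seqProd (path Y ω) n : Matrix (Fin d) (Fin d) ℝ) :=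
        (rowMin_pos (seqProd _ n).2).trans_le (rowMin_le_opNorm (seqProd _ n).2.1)
      exact Real.log_le_log hpos (opNorm_le_entrySum (seqProd _ n).2.1)
  have : lyapunov μ = hsub.lim := hlim2.limUnder_eq
  rw [this]
  exact hlim

end Random

/-! ### Almost sure growth of the smallest entry and of the sum of entries -/

section Growth

variable {d : ℕ} [NeZero d] {μ : Measure (allowable d)} {Ω : Type*} [MeasurableSpace Ω]
  {P : Measure Ω} [IsProbabilityMeasure P] {Y : ℕ → Ω → allowable d}

lemma strictlyPositive_eq :
    strictlyPositive d = {g : allowable d | 0 < minEntry (g : Matrix (Fin d) (Fin d) ℝ)} := by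
  ext g
  exact ⟨fun h => minEntry_pos h, fun h i j => lt_of_lt_of_le h (minEntry_le _ i j)⟩

omit [NeZero d] in
lemma dependsOn_indicator_seqProd (r : ℕ) (S : Set (allowable d)) :
    DependsOn ({y : ℕ → allowable d | seqProd y r ∈ S}.indicator (1 : (ℕ → allowable d) → ℝ))
      (Set.Iio r) := by
  intro y y' h
  have e : seqProd y r = seqProd y' r := seqProd_congr fun k hk => h k hk
  by_cases hy : seqProd y r ∈ S
  · have hy' : seqProd y' r ∈ S := e ▸ hy
    rw [Set.indicator_of_mem (by exact hy), Set.indicator_of_mem (by exact hy')]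
    rfl
  · have hy' : seqProd y' r ∉ S := e ▸ hy
    rw [Set.indicator_of_notMem (by exact hy), Set.indicator_of_notMem (by exact hy')]

lemma minEntry_seqProd_pos_of_le {y : ℕ → allowable d} {N n : ℕ} (hn : N ≤ n)
    (h : 0 < minEntry (seqProd y N : Matrix (Fin d) (Fin d) ℝ)) :
    0 < minEntry (seqProd y n : Matrix (Fin d) (Fin d) ℝ) := by
  induction n, hn using Nat.le_induction with
  | base => exact h
  | succ n _ ih => exact minEntry_mul_pos (y n) _ ih

/-- Under strict contraction the random products almost surely become strictly positive. -/
lemma ae_exists_minEntry_pos (hYm : ∀ n, Measurable (Y n)) (hYlaw : ∀ n, P.map (Y n) = μ)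
    (hYind : iIndepFun Y P) (hμ : StrictlyContracting μ) :
    ∀ᵐ ω ∂P, ∃ n, 0 < minEntry (seqProd (path Y ω) n : Matrix (Fin d) (Fin d) ℝ) := by
  obtain ⟨r, -, hr⟩ := hμ
  have hS : MeasurableSet (strictlyPositive d) := by
    rw [strictlyPositive_eq]
    exact measurable_minEntry measurableSet_Ioi
  have hB : MeasurableSet {y : ℕ → allowable d | seqProd y r ∈ strictlyPositive d} :=
    measurable_seqProd r hS
  set B := {y : ℕ → allowable d | seqProd y r ∈ strictlyPositive d}
  have hBΩ : MeasurableSet (path Y ⁻¹' B) := measurable_path hYm hB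
  have hind : (fun ω => B.indicator (1 : (ℕ → allowable d) → ℝ) (path Y ω))
      = (path Y ⁻¹' B).indicator 1 := rfl
  have hPB : 0 < P (path Y ⁻¹' B) := by
    have hm : Measurable fun ω => seqProd (path Y ω) r :=
      (measurable_seqProd r).comp (measurable_path hYm)
    rw [← map_seqProd_path hYm hYlaw hYind r, Measure.map_apply hm hS] at hr
    exact hr
  -- Disjoint blocks of length `r` have strictly positive product with positive asymptotic
  -- frequency, so at least one does. Multiplying that block on the right by the past keeps all
  -- entries positive.
  have hslln := strong_law_blocks (K := r) hYm hYlaw hYind (Φ := B.indicator 1)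
    (measurable_one.indicator hB)
    (dependsOn_indicator_seqProd r _)
    (by rw [hind]; exact (integrable_const (1 : ℝ)).indicator hBΩ)
  rw [hind, integral_indicator_one hBΩ] at hslln
  have hpos : 0 < P.real (path Y ⁻¹' B) := ENNReal.toReal_pos hPB.ne' (measure_ne_top _ _)
  filter_upwards [hslln] with ω hω
  obtain ⟨n, hn⟩ := (hω.eventually_const_lt hpos).exists
  by_contra hcon
  push Not at hcon
  refine hn.ne' ?_
  rw [Finset.sum_eq_zero, zero_div]
  intro j _
  refine Set.indicator_of_notMem (fun hmem => ?_) _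
  have h1 : 0 < minEntry (seqProd (shift (j * r) (path Y ω)) r : Matrix (Fin d) (Fin d) ℝ) :=
    minEntry_pos hmem
  have h2 := minEntry_pos_mul _ (seqProd (path Y ω) (j * r)) h1
  rw [← seqProd_add] at h2
  exact absurd h2 (not_lt.2 (hcon _))

/-- The smallest entry of a long random product is bounded below with probability close to `1`. -/
lemma exists_measure_minEntry_lt (hYm : ∀ n, Measurable (Y n))
    (hpos : ∀ᵐ ω ∂P, ∃ n, 0 < minEntry (seqProd (path Y ω) n : Matrix (Fin d) (Fin d) ℝ))
    {η : ℝ} (hη : 0 < η) :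
    ∃ R : ℕ, ∃ ε : ℝ, 0 < ε ∧ ε ≤ 1 ∧ P.real {ω | minEntry
      (seqProd (path Y ω) R : Matrix (Fin d) (Fin d) ℝ) < ε} < η := by
  set f : ℕ → Ω → ℝ := fun n ω =>
    minEntry (seqProd (path Y ω) n : Matrix (Fin d) (Fin d) ℝ) with hf
  have hfm : ∀ n, Measurable (f n) := fun n =>
    measurable_minEntry.comp ((measurable_seqProd n).comp (measurable_path hYm))
  -- Positivity persists, so the events that the smallest entry is not yet positive decrease, to a
  -- null set; this fixes `R`. With `R` fixed, a second continuity argument replaces zero by a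
  -- threshold 1/(k + 1).
  have h1 := tendsto_measure_iInter_atTop (μ := P) (s := fun n => {ω | f n ω ≤ 0})
    (fun n => (measurableSet_le (hfm n) measurable_const).nullMeasurableSet)
    (fun m n hmn ω hω => not_lt.1 fun h => not_lt.2 hω (minEntry_seqProd_pos_of_le hmn h))
    ⟨0, measure_ne_top _ _⟩
  have h1' : P (⋂ n, {ω | f n ω ≤ 0}) = 0 := by
    refine measure_mono_null (fun ω hω => ?_) hpos
    simp only [Set.mem_iInter, Set.mem_ofPred_eq] at hω
    simpa [Set.mem_compl_iff] using hω
  rw [h1'] at h1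
  have hη' : (0 : ℝ≥0∞) < ENNReal.ofReal η := ENNReal.ofReal_pos.2 hη
  obtain ⟨R, hR⟩ := (h1.eventually_lt_const hη').exists
  have h2 := tendsto_measure_iInter_atTop (μ := P)
    (s := fun k : ℕ => {ω | f R ω < 1 / ((k : ℝ) + 1)})
    (fun n => (measurableSet_lt (hfm R) measurable_const).nullMeasurableSet)
    (fun m n hmn ω (hω : f R ω < _) =>
      show f R ω < _ from hω.trans_le (Nat.one_div_le_one_div hmn))
    ⟨0, measure_ne_top _ _⟩
  have h2' : (⋂ k : ℕ, {ω | f R ω < 1 / ((k : ℝ) + 1)}) = {ω | f R ω ≤ 0} := by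
    ext ω
    simp only [Set.mem_iInter, Set.mem_ofPred_eq]
    constructor
    · intro h
      exact ge_of_tendsto' tendsto_one_div_add_atTop_nhds_zero_nat fun k => (h k).le
    · intro h k
      exact h.trans_lt Nat.one_div_pos_of_nat
  rw [h2'] at h2
  obtain ⟨k, hk⟩ := (h2.eventually_lt_const hR).exists
  refine ⟨R, 1 / ((k : ℝ) + 1), Nat.one_div_pos_of_nat, ?_, ?_⟩
  · rw [div_le_one (by positivity)]
    linarith [(Nat.cast_nonneg k : (0 : ℝ) ≤ k)]
  · exact (ENNReal.lt_ofReal_iff_toReal_lt (measure_ne_top _ _)).1 hk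

omit [NeZero d] [IsProbabilityMeasure P] in
lemma indepFun_indicator_sum_logSize (hYm : ∀ n, Measurable (Y n)) (hYind : iIndepFun Y P)
    (L R : ℕ) {S : Set (allowable d)} (hS : MeasurableSet S) :
    IndepFun (fun ω => {y : ℕ → allowable d | seqProd y R ∈ S}.indicator
        (1 : (ℕ → allowable d) → ℝ) (shift L (path Y ω)))
      (fun ω => ∑ k ∈ Finset.range L, logSize (Y k ω : Matrix (Fin d) (Fin d) ℝ)) P := by
  have h1 : DependsOn (fun y : ℕ → allowable d =>
      ∑ k ∈ Finset.range L, logSize (y k : Matrix (Fin d) (Fin d) ℝ)) (Set.Iio L) := by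
    intro y y' h
    refine Finset.sum_congr rfl fun k hk => ?_
    have e : y k = y' k := h k (Finset.mem_range.1 hk)
    rw [e]
  have h2 : MeasurableSet {y : ℕ → allowable d | seqProd y R ∈ S} := measurable_seqProd R hS
  have h3 := indepFun_shift (a := 0) (b := L) hYm hYind (measurable_sum_logSize L)
    ((measurable_one (α := ℝ)).indicator h2) h1 (dependsOn_indicator_seqProd R S) (by simp)
  simp only [shift_zero, path_apply] at h3
  exact h3.symm

omit [NeZero d] in
lemma integral_const_add_sub_sub (c : ℝ) {f g h : Ω → ℝ} (hf : Integrable f P)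
    (hg : Integrable g P) (hh : Integrable h P) :
    Integrable (fun ω => c + f ω - g ω - h ω) P ∧
      ∫ ω, (c + f ω - g ω - h ω) ∂P = c + ∫ ω, f ω ∂P - ∫ ω, g ω ∂P - ∫ ω, h ω ∂P := by
  have h1 : Integrable (fun ω => c + f ω) P := (integrable_const c).add hf
  have h2 : Integrable (fun ω => c + f ω - g ω) P := h1.sub hg
  refine ⟨h2.sub hh, ?_⟩
  rw [integral_sub h2 hh, integral_sub h1 hg, integral_add (integrable_const c) hf]
  simp

/-- The bad event and the `logSize` sum it multiplies depend on disjoint windows, so the expectation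
of their product factorises. -/
lemma integrable_cycleBound (hYm : ∀ n, Measurable (Y n)) (hYlaw : ∀ n, P.map (Y n) = μ)
    (hYind : iIndepFun Y P)
    (hZ : Integrable (fun g : allowable d => logSize (g : Matrix (Fin d) (Fin d) ℝ)) μ)
    (L R : ℕ) (ε : ℝ) :
    Integrable (fun ω => cycleBound L R ε (path Y ω)) P ∧
    ∫ ω, cycleBound L R ε (path Y ω) ∂P = Real.log ε
      + ∫ ω, Real.log (entrySum (seqProd (path Y ω) L : Matrix (Fin d) (Fin d) ℝ)) ∂P
      - P.real {ω | minEntry (seqProd (path Y ω) R : Matrix (Fin d) (Fin d) ℝ) < ε} *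
        (L * ∫ g : allowable d, logSize (g : Matrix (Fin d) (Fin d) ℝ) ∂μ)
      - R * ∫ g : allowable d, logSize (g : Matrix (Fin d) (Fin d) ℝ) ∂μ := by
  set B := {y : ℕ → allowable d | minEntry (seqProd y R : Matrix (Fin d) (Fin d) ℝ) < ε} with hB
  have hBm : MeasurableSet B := measurableSet_minEntry_seqProd_lt R ε
  have hBΩ : MeasurableSet (path Y ⁻¹' B) := measurable_path hYm hBm
  have hind : (fun ω => B.indicator (1 : (ℕ → allowable d) → ℝ) (path Y ω))
      = (path Y ⁻¹' B).indicator 1 := rfl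
  have hid := identDistrib_shift hYm hYlaw hYind (Φ := B.indicator 1)
    (measurable_one.indicator hBm) L
  have i1 : Integrable (fun ω => B.indicator (1 : (ℕ → allowable d) → ℝ)
      (shift L (path Y ω))) P := by
    rw [hid.integrable_iff, hind]
    exact (integrable_const (1 : ℝ)).indicator hBΩ
  have e1 : ∫ ω, B.indicator (1 : (ℕ → allowable d) → ℝ) (shift L (path Y ω)) ∂P
      = P.real (path Y ⁻¹' B) := by
    rw [hid.integral_eq, hind, integral_indicator_one hBΩ]
  have i2 := integrable_sum_logSize_path hYm hYlaw hZ 0 L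
  have e2 := integral_sum_logSize_path hYm hYlaw hZ 0 L
  simp only [zero_add] at i2 e2
  have i3 := integrable_sum_logSize_path hYm hYlaw hZ L R
  have e3 := integral_sum_logSize_path hYm hYlaw hZ L R
  have i4 := integrable_log_entrySum_seqProd hYm hYlaw hZ L
  have hindep : IndepFun (fun ω => B.indicator (1 : (ℕ → allowable d) → ℝ) (shift L (path Y ω)))
      (fun ω => ∑ k ∈ Finset.range L, logSize (Y k ω : Matrix (Fin d) (Fin d) ℝ)) P :=
    indepFun_indicator_sum_logSize hYm hYind L R
      (measurable_minEntry measurableSet_Iio)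
  have i12 := hindep.integrable_mul i1 i2
  have e12 := hindep.integral_mul_eq_mul_integral i1.aestronglyMeasurable
    i2.aestronglyMeasurable
  simp only [Pi.mul_def] at i12 e12
  rw [e1, e2] at e12
  have key := integral_const_add_sub_sub (Real.log ε) i4 i12 i3
  rw [e12, e3] at key
  simp only [cycleBound, path_apply]
  exact key

/-- The order of choices matters: `R` and `ε` are fixed first, making the cost of bad windows less
than `δ` per step; then `L` grows, and the constants `log ε` and `R * z` and the extra `R` steps
become negligible. -/
lemma exists_integral_cycleBound (hYm : ∀ n, Measurable (Y n)) (hYlaw : ∀ n, P.map (Y n) = μ)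
    (hYind : iIndepFun Y P)
    (hZ : Integrable (fun g : allowable d => logSize (g : Matrix (Fin d) (Fin d) ℝ)) μ)
    (hpos : ∀ᵐ ω ∂P, ∃ n, 0 < minEntry (seqProd (path Y ω) n : Matrix (Fin d) (Fin d) ℝ))
    {δ : ℝ} (hδ : 0 < δ) :
    ∃ L R : ℕ, ∃ ε : ℝ, 1 ≤ L ∧ 0 < ε ∧ ε ≤ 1 ∧
      lyapunov μ - δ < (∫ ω, cycleBound L R ε (path Y ω) ∂P) / ((L + R : ℕ) : ℝ) := by
  set z := ∫ g : allowable d, logSize (g : Matrix (Fin d) (Fin d) ℝ) ∂μ with hz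
  have hz0 : 0 ≤ z := integral_nonneg fun g => logSize_nonneg _
  obtain ⟨R, ε, hε, hε1, hp⟩ := exists_measure_minEntry_lt hYm hpos
    -- Ensures `p * z < δ`; adding 1 covers the case `z = 0`.
    (η := δ / (z + 1)) (by positivity)
  set p := P.real {ω | minEntry (seqProd (path Y ω) R : Matrix (Fin d) (Fin d) ℝ) < ε} with hpdef
  have hpz : p * z < δ := by
    rw [lt_div_iff₀ (by positivity)] at hp
    have : 0 ≤ p := measureReal_nonneg
    nlinarith
  set u : ℕ → ℝ := fun n =>
    ∫ ω, Real.log (entrySum (seqProd (path Y ω) n : Matrix (Fin d) (Fin d) ℝ)) ∂P with hu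
  have hlim := tendsto_integral_log_entrySum hYm hYlaw hYind hZ
  have hratio : Tendsto (fun n : ℕ => (n : ℝ) / (n + R)) atTop (𝓝 1) :=
    tendsto_natCast_div_add_atTop (R : ℝ)
  have hconst : Tendsto (fun n : ℕ => (Real.log ε - R * z) / n) atTop (𝓝 0) :=
    tendsto_const_div_atTop_nhds_zero_nat _
  have htot : Tendsto (fun n : ℕ => ((n : ℝ) / (n + R)) *
      ((Real.log ε - R * z) / n + u n / n - p * z)) atTop
      (𝓝 (1 * (0 + lyapunov μ - p * z))) :=
    hratio.mul ((hconst.add hlim).sub_const _)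
  have hlt : lyapunov μ - δ < 1 * (0 + lyapunov μ - p * z) := by linarith
  obtain ⟨L, hL, hL1⟩ := ((htot.eventually_const_lt hlt).and (eventually_ge_atTop 1)).exists
  refine ⟨L, R, ε, hL1, hε, hε1, hL.trans_le (le_of_eq ?_)⟩
  rw [(integrable_cycleBound hYm hYlaw hYind hZ L R ε).2]
  have hL' : (L : ℝ) ≠ 0 := by exact_mod_cast (Nat.one_le_iff_ne_zero.1 hL1)
  have hLR : (L : ℝ) + R ≠ 0 := by positivity
  push_cast
  simp only [hu]
  field_simp
  ring

omit [NeZero d] [IsProbabilityMeasure P] in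
lemma ae_tendsto_mean_logSize (hYm : ∀ n, Measurable (Y n)) (hYlaw : ∀ n, P.map (Y n) = μ)
    (hYind : iIndepFun Y P)
    (hZ : Integrable (fun g : allowable d => logSize (g : Matrix (Fin d) (Fin d) ℝ)) μ) :
    ∀ᵐ ω ∂P, Tendsto (fun n : ℕ => (∑ k ∈ Finset.range n,
      logSize (Y k ω : Matrix (Fin d) (Fin d) ℝ)) / n) atTop
      (𝓝 (∫ g : allowable d, logSize (g : Matrix (Fin d) (Fin d) ℝ) ∂μ)) := by
  have h := strong_law_blocks (K := 1) hYm hYlaw hYind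
    (Φ := fun y => logSize (y 0 : Matrix (Fin d) (Fin d) ℝ))
    (measurable_logSize.comp (measurable_pi_apply 0)) (fun y y' h => by simp only [h 0 (by simp)])
    (integrable_logSize_path hYm hYlaw hZ 0)
  simpa [integral_logSize_path hYm hYlaw] using h

lemma ae_eventually_log_minEntry_ge (hYm : ∀ n, Measurable (Y n))
    (hYlaw : ∀ n, P.map (Y n) = μ) (hYind : iIndepFun Y P)
    (hZ : Integrable (fun g : allowable d => logSize (g : Matrix (Fin d) (Fin d) ℝ)) μ)
    (hpos : ∀ᵐ ω ∂P, ∃ n, 0 < minEntry (seqProd (path Y ω) n : Matrix (Fin d) (Fin d) ℝ))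
    {δ : ℝ} (hδ : 0 < δ) :
    ∀ᵐ ω ∂P, ∀ᶠ n : ℕ in atTop, (lyapunov μ - δ) * n ≤
      Real.log (minEntry (seqProd (path Y ω) n : Matrix (Fin d) (Fin d) ℝ)) := by
  obtain ⟨L, R, ε, hL, hε, hε1, hlt⟩ := exists_integral_cycleBound hYm hYlaw hYind hZ hpos hδ
  have hslln := strong_law_blocks (K := L + R) hYm hYlaw hYind (measurable_cycleBound L R ε)
    (dependsOn_cycleBound L R ε) (integrable_cycleBound hYm hYlaw hYind hZ L R ε).1
  filter_upwards [hslln, ae_tendsto_mean_logSize hYm hYlaw hYind hZ, hpos] with ω h1 h2 ⟨N, hN⟩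
  set a : ℕ → ℝ := fun n =>
    -Real.log (minEntry (seqProd (path Y ω) n : Matrix (Fin d) (Fin d) ℝ)) with ha
  -- The averaging lemma bounds growth from above, hence the signs. It is started at a time `N` when
  -- the product is already positive, since `Real.log` of a vanishing entry would be the default
  -- value 0.
  have key := eventually_le_mul_of_block_le (a := a) (N := N) (L := L + R) (by omega)
    (X := fun j => -cycleBound L R ε (shift (j * (L + R)) (path Y ω)))
    (Z := fun k => logSize (Y k ω : Matrix (Fin d) (Fin d) ℝ))
    (x := -∫ ω, cycleBound L R ε (path Y ω) ∂P) (c := -(lyapunov μ - δ))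
    (fun n hn => by
      have h := le_log_minEntry_mul (Y n ω) (seqProd (path Y ω) n)
        (minEntry_seqProd_pos_of_le hn hN)
      have h' := neg_abs_le (Real.log (rowMin (Y n ω : Matrix (Fin d) (Fin d) ℝ)))
      have h'' := abs_nonneg (Real.log (entrySum (Y n ω : Matrix (Fin d) (Fin d) ℝ)))
      simp only [ha, seqProd, logSize, path_apply]
      linarith)
    (fun j hj => by
      have h := cycleBound_add_le hL hε hε1 (R := R) (shift (j * (L + R)) (path Y ω))
        (seqProd (path Y ω) (j * (L + R))) (minEntry_seqProd_pos_of_le hj hN)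
      rw [← seqProd_add] at h
      simp only [ha, add_mul, one_mul] at h ⊢
      linarith)
    (by
      simp only [Finset.sum_neg_distrib, neg_div]
      exact h1.neg)
    h2 (by rw [neg_div]; linarith)
  filter_upwards [key] with n hn
  simp only [ha] at hn
  linarith

/-- Submultiplicativity over blocks of a length `L` whose normalized expectation is already below
the target rate. -/
lemma ae_eventually_log_entrySum_le (hYm : ∀ n, Measurable (Y n))
    (hYlaw : ∀ n, P.map (Y n) = μ) (hYind : iIndepFun Y P)
    (hZ : Integrable (fun g : allowable d => logSize (g : Matrix (Fin d) (Fin d) ℝ)) μ)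
    {δ : ℝ} (hδ : 0 < δ) :
    ∀ᵐ ω ∂P, ∀ᶠ n : ℕ in atTop,
      Real.log (entrySum (seqProd (path Y ω) n : Matrix (Fin d) (Fin d) ℝ)) ≤
        (lyapunov μ + δ) * n := by
  have hlim := tendsto_integral_log_entrySum hYm hYlaw hYind hZ
  obtain ⟨L, hL, hL1⟩ := ((hlim.eventually_lt_const
    (by linarith : lyapunov μ < lyapunov μ + δ)).and (eventually_ge_atTop 1)).exists
  have hslln := strong_law_blocks (K := L) hYm hYlaw hYind
    (measurable_log_entrySum_seqProd (d := d) L)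
    (fun y y' h => by
      have : seqProd y L = seqProd y' L := seqProd_congr fun k hk => h k hk
      simp only [this])
    (integrable_log_entrySum_seqProd hYm hYlaw hZ L)
  filter_upwards [hslln, ae_tendsto_mean_logSize hYm hYlaw hYind hZ] with ω h1 h2
  refine eventually_le_mul_of_block_le (N := 0) (L := L) (by omega) (fun n _ => ?_) (fun j _ => ?_)
    h1 h2 hL
  · have h := log_entrySum_mul_le (Y n ω) (seqProd (path Y ω) n)
    have h' := le_abs_self (Real.log (entrySum (Y n ω : Matrix (Fin d) (Fin d) ℝ)))
    have h'' := abs_nonneg (Real.log (rowMin (Y n ω : Matrix (Fin d) (Fin d) ℝ)))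
    simp only [seqProd, logSize, path_apply]
    linarith
  · rw [add_mul, one_mul, seqProd_add]
    have h := log_entrySum_mul_le (seqProd (shift (j * L) (path Y ω)) L)
      (seqProd (path Y ω) (j * L))
    linarith

/-- Almost surely the logarithms of the smallest entry and of the sum of the entries of the random
products both grow linearly, at the rate given by the Lyapunov exponent. -/
theorem ae_tendsto_log_minEntry_and_log_entrySum (hYm : ∀ n, Measurable (Y n))
    (hYlaw : ∀ n, P.map (Y n) = μ) (hYind : iIndepFun Y P)
    (hZ : Integrable (fun g : allowable d => logSize (g : Matrix (Fin d) (Fin d) ℝ)) μ)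
    (hμ : StrictlyContracting μ) :
    ∀ᵐ ω ∂P,
      (∀ᶠ n in atTop, 0 < minEntry (seqProd (path Y ω) n : Matrix (Fin d) (Fin d) ℝ)) ∧
      Tendsto (fun n : ℕ =>
        Real.log (minEntry (seqProd (path Y ω) n : Matrix (Fin d) (Fin d) ℝ)) / n) atTop
        (𝓝 (lyapunov μ)) ∧
      Tendsto (fun n : ℕ =>
        Real.log (entrySum (seqProd (path Y ω) n : Matrix (Fin d) (Fin d) ℝ)) / n) atTop
        (𝓝 (lyapunov μ)) := by
  have hpos := ae_exists_minEntry_pos hYm hYlaw hYind hμ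
  -- A countable family of margins, so that one almost sure event serves them all.
  have hδ : ∀ k : ℕ, (0 : ℝ) < 1 / ((k : ℝ) + 1) := fun k => Nat.one_div_pos_of_nat
  have hlow := ae_all_iff.2 fun k : ℕ =>
    ae_eventually_log_minEntry_ge hYm hYlaw hYind hZ hpos (hδ k)
  have hup := ae_all_iff.2 fun k : ℕ => ae_eventually_log_entrySum_le hYm hYlaw hYind hZ (hδ k)
  filter_upwards [hpos, hlow, hup] with ω ⟨N, hN⟩ hl hu
  have hev : ∀ᶠ n in atTop,
      0 < minEntry (seqProd (path Y ω) n : Matrix (Fin d) (Fin d) ℝ) := by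
    filter_upwards [eventually_ge_atTop N] with n hn using minEntry_seqProd_pos_of_le hn hN
  have hle : ∀ᶠ n : ℕ in atTop,
      Real.log (minEntry (seqProd (path Y ω) n : Matrix (Fin d) (Fin d) ℝ)) / n ≤
      Real.log (entrySum (seqProd (path Y ω) n : Matrix (Fin d) (Fin d) ℝ)) / n := by
    filter_upwards [hev] with n hn
    exact div_le_div_of_nonneg_right (Real.log_le_log hn
      ((minEntry_le_rowMin (seqProd _ n).2.1).trans (rowMin_le_entrySum (seqProd _ n).2.1)))
      (Nat.cast_nonneg n)
  have hlow' : ∀ c < lyapunov μ, ∀ᶠ n : ℕ in atTop,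
      c < Real.log (minEntry (seqProd (path Y ω) n : Matrix (Fin d) (Fin d) ℝ)) / n := by
    intro c hc
    obtain ⟨k, hk⟩ := exists_nat_one_div_lt (sub_pos.2 hc)
    filter_upwards [hl k, eventually_gt_atTop 0] with n hn hn0
    have hn0' : (0 : ℝ) < n := by exact_mod_cast hn0
    refine lt_of_lt_of_le ?_ ((le_div_iff₀ hn0').2 hn)
    linarith
  have hup' : ∀ c, lyapunov μ < c → ∀ᶠ n : ℕ in atTop,
      Real.log (entrySum (seqProd (path Y ω) n : Matrix (Fin d) (Fin d) ℝ)) / n < c := by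
    intro c hc
    obtain ⟨k, hk⟩ := exists_nat_one_div_lt (sub_pos.2 hc)
    filter_upwards [hu k, eventually_gt_atTop 0] with n hn hn0
    have hn0' : (0 : ℝ) < n := by exact_mod_cast hn0
    refine lt_of_le_of_lt ((div_le_iff₀ hn0').2 hn) ?_
    linarith
  refine ⟨hev, tendsto_order.2 ⟨hlow', fun c hc => ?_⟩, tendsto_order.2 ⟨fun c hc => ?_, hup'⟩⟩
  · filter_upwards [hle, hup' c hc] with n h1 h2 using h1.trans_lt h2
  · filter_upwards [hle, hlow' c hc] with n h1 h2 using h2.trans_le h1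

end Growth

/-! ### Coefficients on the simplex and extended-real logarithms -/

section Coefficients

variable {d : ℕ} [NeZero d]

omit [NeZero d] in
lemma exists_logCoeff_eq {g : Matrix (Fin d) (Fin d) ℝ} (hg : ∀ i j, 0 ≤ g i j)
    (hm : 0 < minEntry g) {x y : Fin d → ℝ} (hx : x ∈ unitSimplex d) (hy : y ∈ unitSimplex d) :
    ∃ t : ℝ, logCoeff g x y = t ∧ Real.log (minEntry g) ≤ t ∧ t ≤ Real.log (entrySum g) := by
  have h1 := minEntry_le_coeff (g := g) hx hy
  have h2 := coeff_le_entrySum hg hx hy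
  have hpos := hm.trans_le h1
  exact ⟨_, ENNReal.log_ofReal_of_pos hpos, Real.log_le_log hm h1, Real.log_le_log hpos h2⟩

lemma exists_iInf_logCoeff_eq {g : Matrix (Fin d) (Fin d) ℝ} (hg : ∀ i j, 0 ≤ g i j)
    (hm : 0 < minEntry g) :
    ∃ t : ℝ, (⨅ x ∈ unitSimplex d, ⨅ y ∈ unitSimplex d, logCoeff g x y) = t ∧
      Real.log (minEntry g) ≤ t ∧ t ≤ Real.log (entrySum g) := by
  set I := ⨅ x ∈ unitSimplex d, ⨅ y ∈ unitSimplex d, logCoeff g x y with hI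
  have h1 : (Real.log (minEntry g) : EReal) ≤ I := by
    refine le_iInf₂ fun x hx => le_iInf₂ fun y hy => ?_
    obtain ⟨t, ht, ht1, -⟩ := exists_logCoeff_eq hg hm hx hy
    rw [ht]
    exact_mod_cast ht1
  have hs := single_mem_unitSimplex (0 : Fin d)
  obtain ⟨t, ht, -, ht2⟩ := exists_logCoeff_eq hg hm hs hs
  have h2 : I ≤ (Real.log (entrySum g) : EReal) :=
    (iInf₂_le _ hs).trans ((iInf₂_le _ hs).trans (by rw [ht]; exact_mod_cast ht2))
  have hbot : I ≠ ⊥ := ((EReal.bot_lt_coe _).trans_le h1).ne'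
  have htop : I ≠ ⊤ := (h2.trans_lt (EReal.coe_lt_top _)).ne
  refine ⟨I.toReal, (EReal.coe_toReal htop hbot).symm, ?_, ?_⟩
  · rw [← EReal.coe_le_coe_iff, EReal.coe_toReal htop hbot]; exact h1
  · rw [← EReal.coe_le_coe_iff, EReal.coe_toReal htop hbot]; exact h2

/-- The right-hand side depends only on the endpoints `a` and `b`, which makes the estimate uniform
over the simplex. -/
lemma abs_div_sub_le {t a b l : ℝ} (n : ℕ) (ha : a ≤ t) (hb : t ≤ b) :
    ((t : EReal) / (n : EReal) - (l : EReal)).abs ≤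
      ENNReal.ofReal (max |a / n - l| |b / n - l|) := by
  have e : (t : EReal) / (n : EReal) - (l : EReal) = ((t / n - l : ℝ) : EReal) := by
    rw [EReal.coe_sub, EReal.coe_div, EReal.coe_natCast]
  rw [e, EReal.abs_def]
  refine ENNReal.ofReal_le_ofReal (abs_le_max_abs_abs ?_ ?_)
  · exact sub_le_sub_right (div_le_div_of_nonneg_right ha (Nat.cast_nonneg n)) l
  · exact sub_le_sub_right (div_le_div_of_nonneg_right hb (Nat.cast_nonneg n)) l

lemma tendsto_ofReal_max_abs {a b : ℕ → ℝ} {l : ℝ} (ha : Tendsto a atTop (𝓝 l))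
    (hb : Tendsto b atTop (𝓝 l)) :
    Tendsto (fun n => ENNReal.ofReal (max |a n - l| |b n - l|)) atTop (𝓝 0) := by
  have h : Tendsto (fun n => max |a n - l| |b n - l|) atTop (𝓝 (max |l - l| |l - l|)) :=
    ((ha.sub_const l).abs).max ((hb.sub_const l).abs)
  simpa using ENNReal.tendsto_ofReal h

end Coefficients

/-! ### Convergence in mean -/

section Convergence

variable {d : ℕ} {μ : Measure (allowable d)} {Ω : Type*} [MeasurableSpace Ω]
  {P : Measure Ω} [IsProbabilityMeasure P] {Y : ℕ → Ω → allowable d}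

omit [IsProbabilityMeasure P] in
lemma tendsto_integral_abs_mean_logSize_sub (hYm : ∀ n, Measurable (Y n))
    (hYlaw : ∀ n, P.map (Y n) = μ) (hYind : iIndepFun Y P)
    (hZ : Integrable (fun g : allowable d => logSize (g : Matrix (Fin d) (Fin d) ℝ)) μ) :
    Tendsto (fun n : ℕ => ∫ ω, |(∑ k ∈ Finset.range n,
        logSize (Y k ω : Matrix (Fin d) (Fin d) ℝ)) / n
        - ∫ g : allowable d, logSize (g : Matrix (Fin d) (Fin d) ℝ) ∂μ| ∂P) atTop (𝓝 0) := by
  have hm : ∀ k, Measurable fun ω => logSize (Y k ω : Matrix (Fin d) (Fin d) ℝ) := fun k =>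
    measurable_logSize.comp (hYm k)
  have h := strong_law_Lp (μ := P) (p := 1) le_rfl ENNReal.one_ne_top
    (fun k ω => logSize (Y k ω : Matrix (Fin d) (Fin d) ℝ))
    (memLp_one_iff_integrable.2 (integrable_logSize_path hYm hYlaw hZ 0))
    (fun i j hij => (hYind.indepFun hij).comp measurable_logSize measurable_logSize)
    (fun i => (IdentDistrib.mk (hYm i).aemeasurable (hYm 0).aemeasurable
      ((hYlaw i).trans (hYlaw 0).symm)).comp measurable_logSize)
  have h' := (ENNReal.tendsto_toReal ENNReal.zero_ne_top).comp h
  rw [ENNReal.toReal_zero] at h'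
  refine h'.congr fun n => ?_
  have hmeas : Measurable fun ω => (n : ℝ)⁻¹ • (∑ k ∈ Finset.range n,
      logSize (Y k ω : Matrix (Fin d) (Fin d) ℝ))
      - ∫ ω, logSize (Y 0 ω : Matrix (Fin d) (Fin d) ℝ) ∂P :=
    ((Finset.measurable_fun_sum _ fun k _ => hm k).const_mul _).sub_const _
  simp only [Function.comp, eLpNorm_one_eq_lintegral_enorm]
  rw [← integral_norm_eq_lintegral_enorm hmeas.aestronglyMeasurable]
  simp only [integral_logSize_path hYm hYlaw, Real.norm_eq_abs, smul_eq_mul, div_eq_inv_mul]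

/-- Convergence in mean follows from almost sure convergence and a domination by sequences which
converge both almost surely to a constant and in mean. -/
lemma tendsto_integral_abs_sub_zero {X S : ℕ → Ω → ℝ} {c z : ℝ}
    (hX : ∀ n, Integrable (X n) P) (hS : ∀ n, Integrable (S n) P)
    (hXlim : ∀ᵐ ω ∂P, Tendsto (fun n => X n ω) atTop (𝓝 c))
    (hSlim : Tendsto (fun n => ∫ ω, |S n ω - z| ∂P) atTop (𝓝 0)) (hz : 0 ≤ z)
    (hXS : ∀ n ω, |X n ω| ≤ S n ω) :
    Tendsto (fun n => ∫ ω, |X n ω - c| ∂P) atTop (𝓝 0) := by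
  -- With this truncation level, wherever |X - c| exceeds `K` one has |X - c| ≤ S + |c| = K + (S -
  -- z). So the excess over the truncation is at most |S - z|, while the truncated part tends to
  -- zero in mean by dominated convergence.
  set K := z + |c| with hK
  have hK0 : 0 ≤ K := by positivity
  have hD : ∀ n, Integrable (fun ω => |X n ω - c|) P := fun n =>
    ((hX n).sub (integrable_const c)).abs
  have hSD : ∀ n, Integrable (fun ω => |S n ω - z|) P := fun n =>
    ((hS n).sub (integrable_const z)).abs
  have hmin : ∀ n, Integrable (fun ω => min |X n ω - c| K) P := fun n =>
    (hD n).inf (integrable_const K)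
  have hDCT : Tendsto (fun n => ∫ ω, min |X n ω - c| K ∂P) atTop (𝓝 (∫ _, (0 : ℝ) ∂P)) := by
    refine tendsto_integral_of_dominated_convergence (fun _ => K)
      (fun n => (hmin n).aestronglyMeasurable) (integrable_const K) (fun n => ?_) ?_
    · filter_upwards with ω
      rw [Real.norm_of_nonneg (le_min (abs_nonneg _) hK0)]
      exact min_le_right _ _
    · filter_upwards [hXlim] with ω hω
      have h : Tendsto (fun n => min |X n ω - c| K) atTop (𝓝 (min |c - c| K)) :=
        ((hω.sub_const c).abs).min tendsto_const_nhds
      simpa [hK0] using h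
  rw [integral_zero] at hDCT
  have hsum := hDCT.add hSlim
  rw [add_zero] at hsum
  refine tendsto_of_tendsto_of_tendsto_of_le_of_le tendsto_const_nhds hsum
    (fun n => integral_nonneg fun ω => abs_nonneg _) fun n => ?_
  have e : ∫ ω, min |X n ω - c| K ∂P + ∫ ω, |S n ω - z| ∂P
      = ∫ ω, (min |X n ω - c| K + |S n ω - z|) ∂P := (integral_add (hmin n) (hSD n)).symm
  simp only [e]
  refine integral_mono (hD n) ((hmin n).add (hSD n)) fun ω => ?_
  simp only
  rcases le_total (|X n ω - c|) K with h | h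
  · rw [min_eq_left h]
    linarith [abs_nonneg (S n ω - z)]
  · rw [min_eq_right h]
    have h1 := abs_sub (X n ω) c
    have h2 := hXS n ω
    have h3 := le_abs_self (S n ω - z)
    linarith

variable [NeZero d]

/-- Any quantity between the smallest row sum and the sum of the entries has, along the random
products, a logarithm which grows in mean at the rate given by the Lyapunov exponent, as soon as it
does so almost surely. -/
lemma tendstoInL1_log_seqProd (hYm : ∀ n, Measurable (Y n)) (hYlaw : ∀ n, P.map (Y n) = μ)
    (hYind : iIndepFun Y P)
    (hZ : Integrable (fun g : allowable d => logSize (g : Matrix (Fin d) (Fin d) ℝ)) μ)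
    {f : allowable d → ℝ} (hf : Measurable f)
    (hf1 : ∀ g : allowable d, rowMin (g : Matrix (Fin d) (Fin d) ℝ) ≤ f g)
    (hf2 : ∀ g : allowable d, f g ≤ entrySum (g : Matrix (Fin d) (Fin d) ℝ)) {c : ℝ}
    (hlim : ∀ᵐ ω ∂P, Tendsto (fun n : ℕ => Real.log (f (seqProd (path Y ω) n)) / n) atTop (𝓝 c)) :
    TendstoInL1 P (fun n ω => Real.log (f (seqProd (path Y ω) n)) / n) c := by
  have hint : ∀ n : ℕ, Integrable (fun ω => Real.log (f (seqProd (path Y ω) n)) / n) P :=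
    fun n => (integrable_log_seqProd hYm hYlaw hZ hf hf1 hf2 n).div_const _
  have hSint : ∀ n : ℕ, Integrable (fun ω => (∑ k ∈ Finset.range n,
      logSize (Y k ω : Matrix (Fin d) (Fin d) ℝ)) / n) P := fun n =>
    (integrable_finsetSum _ fun k _ => integrable_logSize_path hYm hYlaw hZ k).div_const _
  refine ⟨hint, tendsto_integral_abs_sub_zero hint hSint hlim
    (tendsto_integral_abs_mean_logSize_sub hYm hYlaw hYind hZ)
    (integral_nonneg fun g => logSize_nonneg _) fun n ω => ?_⟩
  rcases Nat.eq_zero_or_pos n with rfl | hn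
  -- At n = 0 both quotients are zero, being divisions by zero.
  · simp
  · rw [abs_div, Nat.abs_cast]
    exact div_le_div_of_nonneg_right
      (abs_log_le_sum_logSize (path Y ω) hn (hf1 _) (hf2 _)) (Nat.cast_nonneg n)

end Convergence

end PositiveMatrix

open PositiveMatrix in
theorem mainTheorem7 {d : ℕ} (hd : 2 ≤ d)
    (μ : Measure (PositiveMatrix.allowable d)) [IsProbabilityMeasure μ]
    (hμ : PositiveMatrix.StrictlyContracting μ)
    (hmom : PositiveMatrix.HasMoment (μ.map PositiveMatrix.transpose) 1)
    {Ω : Type*} [MeasurableSpace Ω] (P : Measure Ω) [IsProbabilityMeasure P]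
    (Y : ℕ → Ω → PositiveMatrix.allowable d)
    (hYm : ∀ n, Measurable (Y n)) (hYlaw : ∀ n, P.map (Y n) = μ) (hYind : iIndepFun Y P) :
    let A : ℕ → Ω → Matrix (Fin d) (Fin d) ℝ := fun n ω => PositiveMatrix.leftProd Y n ω
    let S := PositiveMatrix.unitSimplex d
    let lam : ℝ := PositiveMatrix.lyapunov μ
    (∀ᵐ ω ∂P, Tendsto (fun n : ℕ => ⨆ x ∈ S, ⨆ y ∈ S,
        (PositiveMatrix.logCoeff (A n ω) x y / (n : EReal) - (lam : EReal)).abs) atTop (𝓝 0)) ∧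
    (∀ᵐ ω ∂P, Tendsto (fun n : ℕ =>
        ((⨅ x ∈ S, ⨅ y ∈ S, PositiveMatrix.logCoeff (A n ω) x y) / (n : EReal)
          - (lam : EReal)).abs) atTop (𝓝 0)) ∧
    (∀ᵐ ω ∂P, Tendsto (fun n : ℕ => Real.log (PositiveMatrix.opNorm (A n ω)) / n)
        atTop (𝓝 lam)) ∧
    PositiveMatrix.TendstoInL1 P
        (fun n ω => Real.log (PositiveMatrix.opNorm (A n ω)) / n) lam ∧
    (∀ᵐ ω ∂P, Tendsto (fun n : ℕ => Real.log (PositiveMatrix.specRadius (A n ω)) / n)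
        atTop (𝓝 lam)) ∧
    PositiveMatrix.TendstoInL1 P
        (fun n ω => Real.log (PositiveMatrix.specRadius (A n ω)) / n) lam ∧
    (∀ᵐ ω ∂P, Tendsto (fun n : ℕ => Real.log (PositiveMatrix.vInf (A n ω)) / n)
        atTop (𝓝 lam)) := by
  have : NeZero d := ⟨by omega⟩
  have hZ := integrable_logSize hmom
  have hmain := ae_tendsto_log_minEntry_and_log_entrySum hYm hYlaw hYind hZ hμ
  intro A S lam
  have hA : ∀ n ω, A n ω = (seqProd (path Y ω) n : Matrix (Fin d) (Fin d) ℝ) := fun n ω =>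
    congrArg Subtype.val (leftProd_eq_seqProd Y n ω)
  simp only [hA]
  -- The common squeeze: once the smallest entry is positive, the logarithm of any such `f` is
  -- trapped between two sequences with the same rate.
  have hae : ∀ f : allowable d → ℝ,
      (∀ g : allowable d, minEntry (g : Matrix (Fin d) (Fin d) ℝ) ≤ f g) →
      (∀ g : allowable d, f g ≤ entrySum (g : Matrix (Fin d) (Fin d) ℝ)) →
      ∀ᵐ ω ∂P, Tendsto (fun n : ℕ => Real.log (f (seqProd (path Y ω) n)) / n) atTop (𝓝 lam) := by
    intro f hf1 hf2
    filter_upwards [hmain] with ω ⟨hpos, h1, h2⟩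
    refine tendsto_of_tendsto_of_tendsto_of_le_of_le' h1 h2 ?_ ?_
    · filter_upwards [hpos] with n hn
      exact div_le_div_of_nonneg_right (Real.log_le_log hn (hf1 _)) (Nat.cast_nonneg n)
    · filter_upwards [hpos] with n hn
      exact div_le_div_of_nonneg_right (Real.log_le_log (hn.trans_le (hf1 _)) (hf2 _))
        (Nat.cast_nonneg n)
  have hop := hae (fun g => opNorm (g : Matrix (Fin d) (Fin d) ℝ))
    (fun g => (minEntry_le_rowMin g.2.1).trans (rowMin_le_opNorm g.2.1))
    (fun g => opNorm_le_entrySum g.2.1)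
  have hspec := hae (fun g => specRadius (g : Matrix (Fin d) (Fin d) ℝ))
    (fun g => (minEntry_le_rowMin g.2.1).trans (rowMin_le_specRadius g.2))
    (fun g => specRadius_le_entrySum g.2.1)
  refine ⟨?_, ?_, hop, ?_, hspec, ?_, ?_⟩
  · filter_upwards [hmain] with ω ⟨hpos, h1, h2⟩
    refine tendsto_of_tendsto_of_tendsto_of_le_of_le' tendsto_const_nhds
      (tendsto_ofReal_max_abs h1 h2) (Eventually.of_forall fun _ => zero_le) ?_
    filter_upwards [hpos] with n hn
    refine iSup₂_le fun x hx => iSup₂_le fun y hy => ?_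
    obtain ⟨t, ht, ht1, ht2⟩ := exists_logCoeff_eq (seqProd (path Y ω) n).2.1 hn hx hy
    rw [ht]
    exact abs_div_sub_le n ht1 ht2
  · filter_upwards [hmain] with ω ⟨hpos, h1, h2⟩
    refine tendsto_of_tendsto_of_tendsto_of_le_of_le' tendsto_const_nhds
      (tendsto_ofReal_max_abs h1 h2) (Eventually.of_forall fun _ => zero_le) ?_
    filter_upwards [hpos] with n hn
    obtain ⟨t, ht, ht1, ht2⟩ := exists_iInf_logCoeff_eq (seqProd (path Y ω) n).2.1 hn
    rw [ht]
    exact abs_div_sub_le n ht1 ht2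
  · exact tendstoInL1_log_seqProd hYm hYlaw hYind hZ measurable_opNorm
      (fun g => rowMin_le_opNorm g.2.1) (fun g => opNorm_le_entrySum g.2.1) hop
  · exact tendstoInL1_log_seqProd hYm hYlaw hYind hZ measurable_specRadius
      (fun g => rowMin_le_specRadius g.2) (fun g => specRadius_le_entrySum g.2.1) hspec
  · exact hae (fun g => vInf (g : Matrix (Fin d) (Fin d) ℝ))
      (fun g => minEntry_le_vInf g.2.1) (fun g => vInf_le_entrySum g.2.1)
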